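/- All languages are subsets of $\{0,1\}^*$, and $|w|$ is the length of $w$. A counting machine is a nondeterministic Turing machine that runs in polynomial time, all of whose computation paths end in an accepting or a rejecting state and whose computation tree has nodes of outdegree at most two. $\#\mathrm P$ is the class of functions $g:\{0,1\}^*\to\mathbb N$ (with $0\in\mathbb N$) such that for some counting machine $C$, $g(w)$ is the number of accepting paths of $C$ on input $w$. $\mathrm{FP}$ is the class of functions computable by a deterministic Turing machine in polynomial time (integer values written in binary). $L\in\mathrm{UP}$ iff some polynomial-time nondeterministic Turing machine has exactly one accepting path on every $w\in L$ and no accepting path on every $w\notin L$; $L\in\mathrm{coUP}$ iff the complement of $L$ is in $\mathrm{UP}$. $L\in\mathrm{WAPP}$ iff there are $g\in\#\mathrm P$, a polynomial $p$ and a constant $\epsilon>0$ such that for all $w$: if $w\in L$ then $\frac{1+\epsilon}{2}<\frac{g(w)}{2^{p(|w|)}}\le1$, and if $w\notin L$ then $0\le\frac{g(w)}{2^{p(|w|)}}<\frac{1-\epsilon}{2}$. $L\in\mathrm{postBPP}_{\mathrm{FP}}$ iff there are a polynomial-time probabilistic Turing machine $V$ that outputs two bits $p$ and $o$, an $\mathrm{FP}$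 function $f>0$, a polynomial $q$ and a constant $\epsilon>0$ such that at every random step $V$ chooses between two possibilities with probability $1/2$ each, on every input $w$ the number of random steps is the same for all computation paths, and for all $w$ the outputs of $V$ on input $w$ satisfy: (1) $P_{V_w}(p=1)=\frac{f(w)}{2^{q(|w|)}}$; (2) if $w\in L$ then $\frac{1+\epsilon}{2}\le P_{V_w}(o=1\mid p=1)\le1$; (3) if $w\notin L$ then $0\le P_{V_w}(o=1\mid p=1)\le\frac{1-\epsilon}{2}$. Theorem. $\mathrm{UP}\cap\mathrm{coUP}\subseteq\mathrm{postBPP}_{\mathrm{FP}}\subseteq\mathrm{WAPP}$. -/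

import Mathlib

namespace Complexity

/-- A nondeterministic (or probabilistic) Turing machine with inputs in `{0,1}*` whose halting
states carry an outcome in `α`. It is a Mathlib `FinTM2` machine (finitely many stacks, labels and
internal states), together with an optional second move `alt l` at every label `l`.
At a label `l` with `alt l = none` the machine makes the move `m l` (outdegree one); at a label with
`alt l = some s` it chooses between the two moves `m l` and `s` (outdegree two).
The outcome of a computation path is read off from the internal state in which the path halts.
(Since there are finitely many labels and internal states, a program can write only finitely many
different stack symbols.) -/
structure NTM (α : Type) extends Turing.FinTM2 where
  /-- the second possible move, at the labels where the machine makes a binary choice -/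
  alt : Λ → Option (Turing.TM2.Stmt Γ Λ σ)
  /-- the input alphabet is `{0,1}` -/
  inputAlphabet : Γ k₀ ≃ Bool
  /-- the outcome attached to a halting state -/
  outcome : σ → α

namespace NTM

variable {α : Type}

/-- Configurations: the current label (`none` if halted), the internal state and the stacks. -/
abbrev Cfg (N : NTM α) : Type := N.toFinTM2.Cfg

/-- The initial configuration on input `w`: `w` is on the input stack, all others are empty. -/
def init (N : NTM α) (w : List Bool) : N.Cfg :=
  Turing.initList N.toFinTM2 (w.map N.inputAlphabet.symm)

/-- The configuration that results from `c` by making the move `s`. -/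
def move (N : NTM α) (s : Turing.TM2.Stmt N.Γ N.Λ N.σ) (c : N.Cfg) : N.Cfg :=
  Turing.TM2.stepAux s c.var c.stk

/-- `N.HaltsAlong c x c'`: the computation path that starts in `c` and whose successive binary
choices are exactly `x` (`false` for the move `m`, `true` for the move `alt`) ends in the halting
configuration `c'`. The complete computation paths from `c` correspond bijectively to the strings
`x` for which such a `c'` exists. -/
inductive HaltsAlong (N : NTM α) : N.Cfg → List Bool → N.Cfg → Prop
  | halt (c : N.Cfg) (hc : c.l = none) : HaltsAlong N c [] c
  | det (c : N.Cfg) (l : N.Λ) (x : List Bool) (c' : N.Cfg) (hl : c.l = some l)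
      (ha : N.alt l = none) (h : HaltsAlong N (N.move (N.m l) c) x c') : HaltsAlong N c x c'
  | left (c : N.Cfg) (l : N.Λ) (s : Turing.TM2.Stmt N.Γ N.Λ N.σ) (x : List Bool) (c' : N.Cfg)
      (hl : c.l = some l) (ha : N.alt l = some s) (h : HaltsAlong N (N.move (N.m l) c) x c') :
      HaltsAlong N c (false :: x) c'
  | right (c : N.Cfg) (l : N.Λ) (s : Turing.TM2.Stmt N.Γ N.Λ N.σ) (x : List Bool) (c' : N.Cfg)
      (hl : c.l = some l) (ha : N.alt l = some s) (h : HaltsAlong N (N.move s c) x c') :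
      HaltsAlong N c (true :: x) c'

/-- `N.HaltsWithin t c`: every computation path from `c` halts after at most `t` steps. -/
inductive HaltsWithin (N : NTM α) : ℕ → N.Cfg → Prop
  | halt (t : ℕ) (c : N.Cfg) (hc : c.l = none) : HaltsWithin N t c
  | step (t : ℕ) (c : N.Cfg) (l : N.Λ) (hl : c.l = some l)
      (h₁ : HaltsWithin N t (N.move (N.m l) c))
      (h₂ : ∀ s, N.alt l = some s → HaltsWithin N t (N.move s c)) : HaltsWithin N (t + 1) c

/-- The machine runs in polynomial time: on every input `w`, every computation path halts after at
most `p(|w|)` steps, for some polynomial `p`. -/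
def PolyTime (N : NTM α) : Prop :=
  ∃ p : Polynomial ℕ, ∀ w : List Bool, N.HaltsWithin (p.eval w.length) (N.init w)

/-- The computation paths of `N` on input `w` (given by their binary choices) whose outcome
lies in `A`. -/
def paths (N : NTM α) (w : List Bool) (A : Set α) : Set (List Bool) :=
  {x | ∃ c' : N.Cfg, N.HaltsAlong (N.init w) x c' ∧ N.outcome c'.var ∈ A}

/-- The number of computation paths of `N` on input `w` whose outcome lies in `A`. -/
noncomputable def numPaths (N : NTM α) (w : List Bool) (A : Set α) : ℕ :=
  (N.paths w A).ncard

/-- The number of random decisions is the same for all computation paths on a given input. -/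
def Balanced (N : NTM α) : Prop :=
  ∀ w : List Bool, ∃ t : ℕ, ∀ x ∈ N.paths w Set.univ, x.length = t

/-- The probability that the outcome of `N` on input `w` lies in `A`, when every binary choice is
made by a fair coin: a path with `t` choices has probability `2⁻ᵗ`. -/
noncomputable def prob (N : NTM α) (w : List Bool) (A : Set α) : ℝ :=
  ∑ᶠ x ∈ N.paths w A, (1 / 2 : ℝ) ^ x.length

end NTM

/-- A counting machine: the outcome `true` means accept and `false` means reject. -/
abbrev CountingMachine : Type 1 := NTM Bool

/-- The number of accepting paths of `N` on input `w`. -/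
noncomputable def CountingMachine.acc (N : CountingMachine) (w : List Bool) : ℕ :=
  NTM.numPaths N w {true}

/-- `FP`: the functions `{0,1}* → ℕ` that a deterministic Turing machine computes in polynomial
time, with values written in binary. -/
def FP : Set (List Bool → ℕ) :=
  {f | Nonempty (Turing.TM2ComputableInPolyTime
    (id : List Bool → List Bool) Computability.encodeNat f)}

/-- `#P`: the functions that count the accepting paths of a polynomial-time counting machine. -/
def SharpP : Set (List Bool → ℕ) :=
  {g | ∃ C : CountingMachine, C.PolyTime ∧ ∀ w, g w = C.acc w}

/-- `UP`: there is a polynomial-time nondeterministic machine with exactly one accepting path on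
the inputs in `L` and none on the others. -/
def UP : Set (Language Bool) :=
  {L | ∃ N : CountingMachine, N.PolyTime ∧
    ∀ w : List Bool, (w ∈ L → N.acc w = 1) ∧ (w ∉ L → N.acc w = 0)}

/-- `coUP`: the complements of the languages in `UP`. -/
def coUP : Set (Language Bool) :=
  {L | Lᶜ ∈ UP}

/-- `WAPP`. -/
def WAPP : Set (Language Bool) :=
  {L | ∃ g ∈ SharpP, ∃ p : Polynomial ℕ, ∃ ε : ℝ, 0 < ε ∧ ∀ w : List Bool,
    (w ∈ L → (1 + ε) / 2 < (g w : ℝ) / 2 ^ (p.eval w.length) ∧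
      (g w : ℝ) / 2 ^ (p.eval w.length) ≤ 1) ∧
    (w ∉ L → 0 ≤ (g w : ℝ) / 2 ^ (p.eval w.length) ∧
      (g w : ℝ) / 2 ^ (p.eval w.length) < (1 - ε) / 2)}

/-- The probability that a machine with output bits `(p, o)` outputs `p = 1`. -/
noncomputable def probPost (V : NTM (Bool × Bool)) (w : List Bool) : ℝ :=
  V.prob w {y | y.1 = true}

/-- The conditional probability of `o = 1` given `p = 1`, for a machine with output
bits `(p, o)`. -/
noncomputable def probOutGivenPost (V : NTM (Bool × Bool)) (w : List Bool) : ℝ :=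
  V.prob w {y | y.2 = true ∧ y.1 = true} / V.prob w {y | y.1 = true}

/-- `postBPP_FP`: bounded-error postselected polynomial time, by a balanced machine `V` with output
bits `(p, o)`, with postselection probability exactly `f(w) / 2^q(|w|)`, where `f > 0` is in `FP`. -/
def postBPP_FP : Set (Language Bool) :=
  {L | ∃ V : NTM (Bool × Bool), V.PolyTime ∧ V.Balanced ∧
    ∃ f ∈ FP, (∀ w, 0 < f w) ∧ ∃ q : Polynomial ℕ, ∃ ε : ℝ, 0 < ε ∧ ∀ w : List Bool,
      probPost V w = (f w : ℝ) / 2 ^ (q.eval w.length) ∧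
      (w ∈ L → (1 + ε) / 2 ≤ probOutGivenPost V w ∧ probOutGivenPost V w ≤ 1) ∧
      (w ∉ L → 0 ≤ probOutGivenPost V w ∧ probOutGivenPost V w ≤ (1 - ε) / 2)}

end Complexity

/-!
All machines are analysed through their computation trees: `NTM.Unfolds` relates a configuration to
the finite binary tree of its choices, and counting paths, probabilities and balancedness become
statements about leaves of trees (`NTM.HasTree.numPaths_eq`, `NTM.HasTree.prob_eq`).

Both inclusions need a machine that runs two given machines on its input with a polynomial supply of
coins, of which every binary choice uses up one. A `Driver` is such a machine; it first prepares
`(n + 2) ^ K` coins on a stack (`Driver.hasTree_of_run`), and the tree of a submachine reappears in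
its own tree, with the leaves replaced by what comes next (`Driver.Run.simulate`). Every polynomial
with natural coefficients can be complemented to some `(X + 2) ^ K`
(`exists_add_eq_X_add_two_pow`), so these supplies suffice.

For `UP ∩ coUP ⊆ postBPP_FP`, guess which of the two machines for `L` and its complement to run, and
toss all coins that are left. Postselect on acceptance together with all these last tosses being
`false`. The two machines together have exactly one accepting path, and it extends to exactly one
postselected path, so the postselection probability is `1 / 2 ^ ((n + 2) ^ K + 1)`, and the guess is
always right under it.

For `postBPP_FP ⊆ WAPP`, let `a` be the number of paths of `V` with outcome `(1, 1)` and `t` the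
number of its coins. The conditional probability is `(a / 2 ^ t) / (f / 2 ^ q)`, so one has to
divide by `f` with a machine that can only count. Let `k` be the number of binary digits of `f` and
`u = 1 - f / 2 ^ k ≤ 1 / 2`. A random `k`-bit number is at least `f` with probability `u`, and it is
zero with probability `2 ^ (-k)`. Drawing such numbers as long as they are at least `f`, and
accepting if the first one that is not occurs within `J` rounds and is zero, has probability
`2 ^ (-k) * (1 + u + ⋯ + u ^ (J - 1)) = (1 - u ^ J) / f` (`count_roundTree_true`). For a constant
`J` the relative error `u ^ J ≤ 2 ^ (-J)` is small compared with `ε` (`approx_div`). The number of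
coins is chosen as `p + q` for a polynomial `p`, and tossing all of them yields the
denominator `2 ^ p`.
-/

namespace Complexity

/-! ### Binary computation trees -/

/-- A finite binary tree with leaves labelled in `β`: the inner nodes are binary choices, the leaves
are the ends of the computation paths. -/
inductive CoinTree (β : Type) : Type
  | leaf (b : β) : CoinTree β
  | node (l r : CoinTree β) : CoinTree β

namespace CoinTree

variable {β γ : Type}

/-- The root-to-leaf paths that end in a leaf with label in `A`
(`false` for left, `true` for right). -/
def paths (A : Set β) : CoinTree β → Set (List Bool)
  | leaf b => {x | x = [] ∧ b ∈ A}
  | node l r => (List.cons false '' l.paths A) ∪ (List.cons true '' r.paths A)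

open Classical in
/-- The number of leaves with label in `A`. -/
noncomputable def count (A : Set β) : CoinTree β → ℕ
  | leaf b => if b ∈ A then 1 else 0
  | node l r => l.count A + r.count A

/-- All leaves are at depth `n`. -/
def Uniform : ℕ → CoinTree β → Prop
  | n, leaf _ => n = 0
  | 0, node _ _ => False
  | n + 1, node l r => l.Uniform n ∧ r.Uniform n

/-- The maximal depth of a leaf. -/
def depth : CoinTree β → ℕ
  | leaf _ => 0
  | node l r => max l.depth r.depth + 1

/-- `b` is the label of a leaf. -/
def Mem (b : β) : CoinTree β → Prop
  | leaf b' => b' = b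
  | node l r => l.Mem b ∨ r.Mem b

/-- Replace every leaf at depth `d` with label `b` by the tree `f (n - d) b`. The number `n`
stands for a supply of coins of which every inner node uses up one; the subtraction truncates, so
that an exhausted supply stays empty. -/
def graft (f : ℕ → β → CoinTree γ) : ℕ → CoinTree β → CoinTree γ
  | n, leaf b => f n b
  | n, node l r => node (graft f (n - 1) l) (graft f (n - 1) r)

theorem ncard_paths (A : Set β) (T : CoinTree β) :
    (T.paths A).Finite ∧ (T.paths A).ncard = T.count A := by
  induction T with
  | leaf b =>
    by_cases hb : b ∈ A
    · simp [paths, count, hb]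
    · simp [paths, count, hb]
  | node l r hl hr =>
    have h1 := hl.1.image (List.cons false)
    have h2 := hr.1.image (List.cons true)
    refine ⟨h1.union h2, ?_⟩
    have hd : Disjoint (List.cons false '' l.paths A) (List.cons true '' r.paths A) := by
      rw [Set.disjoint_left]
      rintro _ ⟨x, _, rfl⟩ ⟨y, _, h⟩
      simp at h
    simp only [paths, count]
    rw [Set.ncard_union_eq hd h1 h2, Set.ncard_image_of_injective _ List.cons_injective,
      Set.ncard_image_of_injective _ List.cons_injective, hl.2, hr.2]

theorem paths_univ_nonempty (T : CoinTree β) : (T.paths Set.univ).Nonempty := by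
  induction T with
  | leaf b => exact ⟨[], by simp [paths]⟩
  | node l r hl _ =>
    obtain ⟨x, hx⟩ := hl
    exact ⟨false :: x, Or.inl ⟨x, hx, rfl⟩⟩

theorem uniform_iff (T : CoinTree β) (n : ℕ) :
    T.Uniform n ↔ ∀ x ∈ T.paths Set.univ, x.length = n := by
  induction T generalizing n with
  | leaf b => simp [Uniform, paths, eq_comm]
  | node l r hl hr =>
    cases n with
    | zero =>
      obtain ⟨x, hx⟩ := l.paths_univ_nonempty
      simp only [Uniform, paths, false_iff, not_forall]
      exact ⟨false :: x, Or.inl ⟨x, hx, rfl⟩, by simp⟩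
    | succ n =>
      simp only [Uniform, paths, hl, hr]
      constructor
      · rintro ⟨h1, h2⟩ _ (⟨x, hx, rfl⟩ | ⟨x, hx, rfl⟩)
        · simp [h1 x hx]
        · simp [h2 x hx]
      · intro h
        exact ⟨fun x hx => by simpa using h _ (Or.inl ⟨x, hx, rfl⟩),
          fun x hx => by simpa using h _ (Or.inr ⟨x, hx, rfl⟩)⟩

theorem paths_mono {A B : Set β} (h : A ⊆ B) (T : CoinTree β) : T.paths A ⊆ T.paths B := by
  induction T with
  | leaf b => exact fun x hx => ⟨hx.1, h hx.2⟩
  | node l r hl hr => exact Set.union_subset_union (Set.image_mono hl) (Set.image_mono hr)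

theorem Uniform.count_le {T : CoinTree β} {n : ℕ} (h : T.Uniform n) (A : Set β) :
    T.count A ≤ 2 ^ n := by
  induction T generalizing n with
  | leaf b => simp only [count]; split_ifs <;> simp [Nat.one_le_two_pow]
  | node l r hl hr =>
    cases n with
    | zero => exact h.elim
    | succ n =>
      have h1 := hl h.1
      have h2 := hr h.2
      simp only [count, pow_succ]
      omega

theorem Uniform.depth_eq {T : CoinTree β} {n : ℕ} (h : T.Uniform n) : T.depth = n := by
  induction T generalizing n with
  | leaf b => simpa [Uniform, depth, eq_comm] using h
  | node l r hl hr =>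
    cases n with
    | zero => exact h.elim
    | succ n => simp [depth, hl h.1, hr h.2]

theorem uniform_graft {T : CoinTree β} {n : ℕ} (f : ℕ → β → CoinTree γ) (h : T.depth ≤ n)
    (hf : ∀ m b, (f m b).Uniform m) : (T.graft f n).Uniform n := by
  induction T generalizing n with
  | leaf b => simpa [graft] using hf n b
  | node l r hl hr =>
    simp only [depth] at h
    cases n with
    | zero => omega
    | succ n => exact ⟨hl (by omega), hr (by omega)⟩

open Classical in
theorem count_graft {A : Set γ} {B : Set β} {c : ℕ} (f : ℕ → β → CoinTree γ)
    (hf : ∀ m b, (f m b).count A = if b ∈ B then c else 0) (n : ℕ) (T : CoinTree β) :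
    (T.graft f n).count A = T.count B * c := by
  induction T generalizing n with
  | leaf b => simp [graft, count, hf]
  | node l r hl hr => simp [graft, count, hl, hr, add_mul]

open Classical in
theorem Uniform.count_graft {A : Set γ} {B : Set β} {c n t : ℕ} {T : CoinTree β}
    (h : T.Uniform t) (f : ℕ → β → CoinTree γ)
    (hf : ∀ b, (f (n - t) b).count A = if b ∈ B then c else 0) :
    (T.graft f n).count A = T.count B * c := by
  induction T generalizing n t with
  | leaf b =>
    obtain rfl : t = 0 := by simpa [Uniform] using h
    simpa [graft, count] using hf b
  | node l r hl hr =>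
    cases t with
    | zero => exact h.elim
    | succ t =>
      have e : n - (t + 1) = n - 1 - t := by omega
      rw [e] at hf
      simp [graft, count, hl h.1 hf, hr h.2 hf, add_mul]

end CoinTree

/-! ### Unfolding a machine into its computation tree -/

namespace NTM

variable {α β : Type} {N : NTM α} {ρ : N.Cfg → β}

/-- `N.Unfolds ρ c T t`: started in `c`, the machine `N` halts within `t` steps on every
computation path, and its computation tree is `T`, where a halting configuration `c'` appears as a
leaf with label `ρ c'`. -/
inductive Unfolds (N : NTM α) (ρ : N.Cfg → β) : N.Cfg → CoinTree β → ℕ → Prop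
  | halt (c : N.Cfg) (t : ℕ) (hc : c.l = none) : Unfolds N ρ c (.leaf (ρ c)) t
  | det (c : N.Cfg) (l : N.Λ) (T : CoinTree β) (t : ℕ) (hl : c.l = some l) (ha : N.alt l = none)
      (h : Unfolds N ρ (N.move (N.m l) c) T t) : Unfolds N ρ c T (t + 1)
  | choice (c : N.Cfg) (l : N.Λ) (s : Turing.TM2.Stmt N.Γ N.Λ N.σ) (T₁ T₂ : CoinTree β) (t : ℕ)
      (hl : c.l = some l) (ha : N.alt l = some s) (h₁ : Unfolds N ρ (N.move (N.m l) c) T₁ t)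
      (h₂ : Unfolds N ρ (N.move s c) T₂ t) : Unfolds N ρ c (.node T₁ T₂) (t + 1)

theorem Unfolds.mono {c : N.Cfg} {T : CoinTree β} {t t' : ℕ} (h : N.Unfolds ρ c T t)
    (ht : t ≤ t') : N.Unfolds ρ c T t' := by
  induction h generalizing t' with
  | halt c t hc => exact .halt c t' hc
  | det c l T t hl ha _ ih =>
    obtain ⟨s, rfl⟩ : ∃ s, t' = s + 1 := ⟨t' - 1, by omega⟩
    exact .det c l T s hl ha (ih (by omega))
  | choice c l s T₁ T₂ t hl ha _ _ ih₁ ih₂ =>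
    obtain ⟨u, rfl⟩ : ∃ s, t' = s + 1 := ⟨t' - 1, by omega⟩
    exact .choice c l s T₁ T₂ u hl ha (ih₁ (by omega)) (ih₂ (by omega))

theorem HaltsWithin.mono {c : N.Cfg} {t t' : ℕ} (h : N.HaltsWithin t c) (ht : t ≤ t') :
    N.HaltsWithin t' c := by
  induction h generalizing t' with
  | halt t c hc => exact .halt t' c hc
  | step t c l hl _ _ ih₁ ih₂ =>
    obtain ⟨s, rfl⟩ : ∃ s, t' = s + 1 := ⟨t' - 1, by omega⟩
    exact .step s c l hl (ih₁ (by omega)) fun s' hs' => ih₂ s' hs' (by omega)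

theorem HaltsWithin.exists_unfolds {c : N.Cfg} {t : ℕ} (h : N.HaltsWithin t c) (ρ : N.Cfg → β) :
    ∃ T, N.Unfolds ρ c T t := by
  induction h with
  | halt t c hc => exact ⟨_, .halt c t hc⟩
  | step t c l hl _ _ ih₁ ih₂ =>
    obtain ⟨T₁, h₁⟩ := ih₁
    cases ha : N.alt l with
    | none => exact ⟨T₁, .det c l T₁ t hl ha h₁⟩
    | some s =>
      obtain ⟨T₂, h₂⟩ := ih₂ s ha
      exact ⟨_, .choice c l s T₁ T₂ t hl ha h₁ h₂⟩

theorem Unfolds.haltsWithin {c : N.Cfg} {T : CoinTree β} {t : ℕ} (h : N.Unfolds ρ c T t) :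
    N.HaltsWithin t c := by
  induction h with
  | halt c t hc => exact .halt t c hc
  | det c l T t hl ha _ ih => exact .step t c l hl ih fun s hs => by simp [ha] at hs
  | choice c l s T₁ T₂ t hl ha _ _ ih₁ ih₂ =>
    refine .step t c l hl ih₁ fun s' hs' => ?_
    obtain rfl : s = s' := by simpa [ha] using hs'
    exact ih₂

theorem Unfolds.depth_le {c : N.Cfg} {T : CoinTree β} {t : ℕ} (h : N.Unfolds ρ c T t) :
    T.depth ≤ t := by
  induction h with
  | halt c t hc => simp [CoinTree.depth]
  | det c l T t hl ha _ ih => omega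
  | choice c l s T₁ T₂ t hl ha _ _ ih₁ ih₂ => simp only [CoinTree.depth]; omega

theorem Unfolds.mem_paths_iff {c : N.Cfg} {T : CoinTree β} {t : ℕ} (h : N.Unfolds ρ c T t)
    (A : Set β) (x : List Bool) :
    x ∈ T.paths A ↔ ∃ c', N.HaltsAlong c x c' ∧ ρ c' ∈ A := by
  induction h generalizing x with
  | halt c t hc =>
    constructor
    · rintro ⟨rfl, hx⟩
      exact ⟨c, .halt c hc, hx⟩
    · rintro ⟨c', h, hA⟩
      cases h with
      | halt => exact ⟨rfl, hA⟩
      | _ => simp_all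
  | det c l T t hl ha _ ih =>
    rw [ih]
    constructor
    · rintro ⟨c', h, hA⟩
      exact ⟨c', .det c l x c' hl ha h, hA⟩
    · rintro ⟨c', h, hA⟩
      cases h with
      | det _ l' _ _ hl' _ h =>
        obtain rfl : l = l' := by simpa [hl] using hl'
        exact ⟨c', h, hA⟩
      | _ => simp_all
  | choice c l s T₁ T₂ t hl ha _ _ ih₁ ih₂ =>
    constructor
    · rintro (⟨y, hy, rfl⟩ | ⟨y, hy, rfl⟩)
      · obtain ⟨c', h, hA⟩ := (ih₁ y).1 hy
        exact ⟨c', .left c l s y c' hl ha h, hA⟩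
      · obtain ⟨c', h, hA⟩ := (ih₂ y).1 hy
        exact ⟨c', .right c l s y c' hl ha h, hA⟩
    · rintro ⟨c', h, hA⟩
      cases h with
      | left _ l' s' y _ hl' ha' h =>
        obtain rfl : l = l' := by simpa [hl] using hl'
        exact Or.inl ⟨y, (ih₁ y).2 ⟨c', h, hA⟩, rfl⟩
      | right _ l' s' y _ hl' ha' h =>
        obtain rfl : l = l' := by simpa [hl] using hl'
        obtain rfl : s = s' := by simpa [ha] using ha'
        exact Or.inr ⟨y, (ih₂ y).2 ⟨c', h, hA⟩, rfl⟩
      | _ => simp_all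

/-- The tree of outcomes of `N` on input `w` is `T`, and `N` needs at most `t` steps. -/
abbrev HasTree (N : NTM α) (w : List Bool) (T : CoinTree α) (t : ℕ) : Prop :=
  N.Unfolds (fun c => N.outcome c.var) (N.init w) T t

theorem HasTree.paths_eq {w : List Bool} {T : CoinTree α} {t : ℕ} (h : N.HasTree w T t)
    (A : Set α) : N.paths w A = T.paths A :=
  Set.ext fun x => (h.mem_paths_iff A x).symm

theorem HasTree.numPaths_eq {w : List Bool} {T : CoinTree α} {t : ℕ} (h : N.HasTree w T t)
    (A : Set α) : N.numPaths w A = T.count A := by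
  rw [numPaths, h.paths_eq, (CoinTree.ncard_paths A T).2]

theorem HasTree.prob_eq {w : List Bool} {T : CoinTree α} {t n : ℕ} (h : N.HasTree w T t)
    (hT : T.Uniform n) (A : Set α) : N.prob w A = T.count A / 2 ^ n := by
  have hfin := CoinTree.ncard_paths A T
  rw [prob, h.paths_eq, finsum_mem_congr (g := fun _ => (1 / 2 : ℝ) ^ n) rfl
    (fun x hx => by
      rw [(T.uniform_iff n).1 hT x (T.paths_mono (Set.subset_univ A) hx)]),
    finsum_mem_eq_finite_toFinset_sum _ hfin.1, Finset.sum_const,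
    ← Set.ncard_eq_toFinset_card _ hfin.1, hfin.2]
  simp [div_eq_mul_inv]

end NTM

/-! ### Polynomials below a power of `X + 2` -/

/-- Every polynomial over `ℕ` is coefficientwise below all sufficiently high powers of `X + 2`. The
set of such polynomials is closed under addition and multiplication by `X`. -/
theorem exists_add_eq_X_add_two_pow (q : Polynomial ℕ) :
    ∃ K : ℕ, ∀ K' ≥ K, ∃ p : Polynomial ℕ, p + q = (Polynomial.X + 2) ^ K' := by
  have key : ∀ q : Polynomial ℕ, (∃ K, ∃ p : Polynomial ℕ, p + q = (Polynomial.X + 2) ^ K) →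
      ∃ K : ℕ, ∀ K' ≥ K, ∃ p : Polynomial ℕ, p + q = (Polynomial.X + 2) ^ K' := by
    rintro q ⟨K, h⟩
    refine ⟨K, fun K' hK => Nat.le_induction h (fun m _ ih => ?_) K' hK⟩
    obtain ⟨p, hp⟩ := ih
    exact ⟨p + (Polynomial.X + 2) ^ m * (Polynomial.X + 1), by
      rw [add_right_comm, hp]; ring⟩
  have hadd : ∀ q₁ q₂ : Polynomial ℕ,
      (∃ K, ∃ p : Polynomial ℕ, p + q₁ = (Polynomial.X + 2) ^ K) →
      (∃ K, ∃ p : Polynomial ℕ, p + q₂ = (Polynomial.X + 2) ^ K) →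
      ∃ K, ∃ p : Polynomial ℕ, p + (q₁ + q₂) = (Polynomial.X + 2) ^ K := by
    intro q₁ q₂ h₁ h₂
    obtain ⟨K₁, h₁⟩ := key q₁ h₁
    obtain ⟨K₂, h₂⟩ := key q₂ h₂
    obtain ⟨p₁, h₁⟩ := h₁ (max K₁ K₂) (le_max_left _ _)
    obtain ⟨p₂, h₂⟩ := h₂ (max K₁ K₂) (le_max_right _ _)
    refine ⟨max K₁ K₂ + 1, p₁ + p₂ + Polynomial.X * (Polynomial.X + 2) ^ max K₁ K₂, ?_⟩
    calc _ = (p₁ + q₁) + (p₂ + q₂) + Polynomial.X * (Polynomial.X + 2) ^ max K₁ K₂ := by ring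
      _ = _ := by rw [h₁, h₂]; ring
  have hmulX : ∀ q : Polynomial ℕ, (∃ K, ∃ p : Polynomial ℕ, p + q = (Polynomial.X + 2) ^ K) →
      ∃ K, ∃ p : Polynomial ℕ, p + q * Polynomial.X = (Polynomial.X + 2) ^ K := by
    rintro q ⟨K, p, h⟩
    refine ⟨K + 1, p * Polynomial.X + 2 * (Polynomial.X + 2) ^ K, ?_⟩
    calc _ = (p + q) * Polynomial.X + 2 * (Polynomial.X + 2) ^ K := by ring
      _ = _ := by rw [h]; ring
  have hC : ∀ a : ℕ, ∃ K, ∃ p : Polynomial ℕ, p + Polynomial.C a = (Polynomial.X + 2) ^ K := by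
    intro a
    induction a with
    | zero => exact ⟨0, 1, by simp⟩
    | succ a ih =>
      rw [Polynomial.C_add]
      exact hadd _ _ ih ⟨1, Polynomial.X + 1, by simp only [map_one]; ring⟩
  apply key
  induction q using Polynomial.induction_on with
  | C a => exact hC a
  | add p q hp hq => exact hadd _ _ hp hq
  | monomial n a h => rw [pow_succ, ← mul_assoc]; exact hmulX _ h

/-! ### Binary expansions -/

/-- The number with binary digits `l`, least significant digit first. -/
def bitsVal : List Bool → ℕ
  | [] => 0
  | b :: l => b.toNat + 2 * bitsVal l

theorem bitsVal_lt (l : List Bool) : bitsVal l < 2 ^ l.length := by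
  induction l with
  | nil => simp [bitsVal]
  | cons b l ih =>
    have := b.toNat_le
    simp only [bitsVal, List.length_cons, pow_succ]
    omega

theorem encodePosNum_spec (n : PosNum) :
    bitsVal (Computability.encodePosNum n) = n ∧
      2 ^ (Computability.encodePosNum n).length ≤ 2 * (n : ℕ) := by
  induction n with
  | one => simp [Computability.encodePosNum, bitsVal]
  | bit0 n ih =>
    simp only [Computability.encodePosNum, bitsVal, List.length_cons, pow_succ,
      PosNum.cast_bit0, ih.1, Bool.toNat_false]
    omega
  | bit1 n ih =>
    simp only [Computability.encodePosNum, bitsVal, List.length_cons, pow_succ,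
      PosNum.cast_bit1, ih.1, Bool.toNat_true]
    omega

/-- The binary expansion of a positive number has that value and no leading zero. -/
theorem encodeNat_spec {n : ℕ} (hn : 0 < n) :
    bitsVal (Computability.encodeNat n) = n ∧
      2 ^ (Computability.encodeNat n).length ≤ 2 * n := by
  have h := Num.to_of_nat n
  unfold Computability.encodeNat
  rcases hm : (n : Num) with _ | m
  · rw [hm] at h
    simp at h
    omega
  · rw [hm] at h
    simpa [Computability.encodeNum, ← h] using encodePosNum_spec m

/-! ### Deterministic machines -/

/-- A deterministic machine, seen as a nondeterministic one without choices. -/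
def NTM.ofFinTM2 {α : Type} (tm : Turing.FinTM2) (e : tm.Γ tm.k₀ ≃ Bool) (a : α) : NTM α where
  toFinTM2 := tm
  alt _ := none
  inputAlphabet := e
  outcome _ := a

theorem NTM.ofFinTM2_unfolds {α : Type} (tm : Turing.FinTM2) (e : tm.Γ tm.k₀ ≃ Bool) (a : α)
    {c c' : tm.Cfg} {m : ℕ} (hc' : c'.l = none)
    (h : StateTransition.EvalsToInTime tm.step c (some c') m) :
    (ofFinTM2 tm e a).Unfolds (β := tm.Cfg) id c (.leaf c') m := by
  obtain ⟨⟨n, hn⟩, hm⟩ := h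
  refine Unfolds.mono (t := n) ?_ hm
  clear hm
  induction n generalizing c with
  | zero =>
    obtain rfl : c = c' := by simpa using hn
    exact .halt (N := ofFinTM2 tm e a) (ρ := id) c 0 hc'
  | succ n ih =>
    rw [Function.iterate_succ_apply] at hn
    obtain ⟨l, v, S⟩ := c
    cases l with
    | none =>
      have hnone : ∀ k : ℕ, (flip bind tm.step)^[k] none = none := by
        intro k
        induction k with
        | zero => rfl
        | succ k ih => rw [Function.iterate_succ_apply]; exact ih
      have e1 : flip bind tm.step (some ⟨none, v, S⟩) = none := rfl
      rw [e1, hnone] at hn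
      cases hn
    | some l => exact .det (N := ofFinTM2 tm e a) (ρ := id) ⟨some l, v, S⟩ l _ n rfl rfl (ih hn)

/-- The machine that empties its only stack and then writes the number `1`. -/
def oneMachine : Turing.FinTM2 where
  K := Unit
  k₀ := ()
  k₁ := ()
  Γ _ := Bool
  Λ := Unit
  main := ()
  σ := Option Bool
  initialState := none
  m _ := .pop () (fun _ x => x) <| .branch Option.isSome (.goto fun _ => ())
    (.push () (fun _ => true) .halt)

theorem one_mem_FP : (fun _ => 1 : List Bool → ℕ) ∈ FP := by
  refine ⟨⟨⟨oneMachine, Equiv.refl _, Equiv.refl _⟩, Polynomial.X + 1, fun w => ?_⟩⟩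
  have key : ∀ (w : List Bool) (v : Option Bool), (flip bind oneMachine.step)^[w.length + 1]
      (some ⟨some (), v, fun _ => w⟩) = some ⟨none, none, fun _ => [true]⟩ := by
    intro w
    induction w with
    | nil =>
      intro v
      rfl
    | cons b w ih =>
      intro v
      rw [List.length_cons, Function.iterate_succ_apply]
      have e1 : flip bind oneMachine.step (some ⟨some (), v, fun _ => b :: w⟩) =
          some ⟨some (), some b, fun _ => w⟩ := by
        change some (Turing.TM2.stepAux _ _ _) = _
        simp [oneMachine]
        rfl
      exact (congrArg _ e1).trans (ih _)
  refine ⟨⟨w.length + 1, ?_⟩, by simp⟩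
  have hinit : ∀ l : List Bool, Turing.initList oneMachine l = ⟨some (), none, fun _ => l⟩ :=
    fun _ => rfl
  have hw : Turing.initList oneMachine (List.map id w) = ⟨some (), none, fun _ => w⟩ :=
    (congrArg (fun l : List Bool => Turing.initList oneMachine l) (List.map_id w)).trans (hinit w)
  exact (congrArg (fun c => (flip bind oneMachine.step)^[w.length + 1] (some c)) hw).trans
    (key w none)

open Turing.TM2 (Stmt stepAux)
open Function (update)

/-! ### Machines that drive two submachines -/

/-- The stacks of a driver besides those of its two submachines: the input, two stacks between which
the input is moved back and forth, a recursion stack, a supply of coins in unary, and a scratch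
stack. -/
inductive Aux
  | inp | fwd | bwd | work | clock | scratch
  deriving DecidableEq

instance : Fintype Aux :=
  ⟨{.inp, .fwd, .bwd, .work, .clock, .scratch}, fun x => by cases x <;> simp⟩

/-- The alphabets of the auxiliary stacks. -/
abbrev Aux.Alphabet (K : ℕ) : Aux → Type
  | work => Fin (K + 1)
  | clock => Unit
  | _ => Bool

/-- The labels of the initial phase of a driver. -/
inductive Setup
  | copy | distribute | backward | expand | forward
  deriving DecidableEq

instance : Fintype Setup :=
  ⟨{.copy, .distribute, .backward, .expand, .forward}, fun x => by cases x <;> simp⟩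

section Types

variable {α : Type} (M : Bool → NTM α) (K : ℕ) (C : Type)

/-- Stack indices of a driver. -/
abbrev DStack : Type := (Σ i, (M i).K) ⊕ Aux

/-- Stack alphabets of a driver. -/
abbrev DAlphabet : DStack M → Type
  | .inl p => (M p.1).Γ p.2
  | .inr a => a.Alphabet K

/-- Labels of a driver; `C` contains the labels of its control program. -/
abbrev DLabel : Type := (Σ i, (M i).Λ) ⊕ (Setup ⊕ C)

/-- Two registers, for the last bit and the last recursion symbol that were read. -/
abbrev Registers : Type := Option Bool × Option (Fin (K + 1))

/-- Internal states of a driver. -/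
abbrev DState : Type := (∀ i, (M i).σ) × Registers K

/-- Moves of a driver. -/
abbrev DStmt : Type := Stmt (DAlphabet M K) (DLabel M C) (DState M K)

/-- Configurations of a driver. -/
abbrev DCfg : Type := Turing.TM2.Cfg (DAlphabet M K) (DLabel M C) (DState M K)

/-- Contents of the auxiliary stacks. -/
structure Store where
  /-- the input -/
  inp : List Bool := []
  /-- the input, before a pass over it -/
  fwd : List Bool := []
  /-- the input, after a pass over it -/
  bwd : List Bool := []
  /-- the recursion stack -/
  work : List (Fin (K + 1)) := []
  /-- the remaining coins -/
  clock : List Unit := []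
  /-- the scratch stack -/
  scratch : List Bool := []

variable {M K C}

/-- All stacks of a driver, from those of the submachines and the auxiliary ones. -/
def stackOf (sub : ∀ i k, List ((M i).Γ k)) (X : Store K) : ∀ k, List (DAlphabet M K k)
  | .inl p => sub p.1 p.2
  | .inr .inp => X.inp
  | .inr .fwd => X.fwd
  | .inr .bwd => X.bwd
  | .inr .work => X.work
  | .inr .clock => X.clock
  | .inr .scratch => X.scratch

section Stacks

variable (sub : ∀ i k, List ((M i).Γ k)) (X : Store K)

@[simp] theorem stackOf_inl (p : Σ i, (M i).K) : stackOf sub X (.inl p) = sub p.1 p.2 := rfl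
@[simp] theorem stackOf_inp : stackOf sub X (.inr .inp) = X.inp := rfl
@[simp] theorem stackOf_fwd : stackOf sub X (.inr .fwd) = X.fwd := rfl
@[simp] theorem stackOf_bwd : stackOf sub X (.inr .bwd) = X.bwd := rfl
@[simp] theorem stackOf_work : stackOf sub X (.inr .work) = X.work := rfl
@[simp] theorem stackOf_clock : stackOf sub X (.inr .clock) = X.clock := rfl
@[simp] theorem stackOf_scratch : stackOf sub X (.inr .scratch) = X.scratch := rfl

@[simp] theorem update_stackOf_inl (p : Σ i, (M i).K) (l : List ((M p.1).Γ p.2)) :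
    update (stackOf sub X) (.inl p) l
      = stackOf (update sub p.1 (update (sub p.1) p.2 l)) X := by
  obtain ⟨i, k⟩ := p
  funext k'
  rcases k' with ⟨j, k'⟩ | a
  · by_cases hj : j = i
    · subst hj
      by_cases hk : k' = k
      · subst hk; simp
      · rw [Function.update_of_ne (by simpa using hk)]
        simp [Function.update_of_ne hk]
    · rw [Function.update_of_ne (fun h => hj (congrArg Sigma.fst (Sum.inl_injective h)))]
      simp [Function.update_of_ne hj]
  · rw [Function.update_of_ne (by simp)]
    cases a <;> rfl

@[simp] theorem update_stackOf_inp (l : List Bool) :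
    update (stackOf sub X) (.inr .inp) l = stackOf sub { X with inp := l } := by
  funext k; rcases k with p | a
  · rfl
  · cases a <;> rfl

@[simp] theorem update_stackOf_fwd (l : List Bool) :
    update (stackOf sub X) (.inr .fwd) l = stackOf sub { X with fwd := l } := by
  funext k; rcases k with p | a
  · rfl
  · cases a <;> rfl

@[simp] theorem update_stackOf_bwd (l : List Bool) :
    update (stackOf sub X) (.inr .bwd) l = stackOf sub { X with bwd := l } := by
  funext k; rcases k with p | a
  · rfl
  · cases a <;> rfl

@[simp] theorem update_stackOf_work (l : List (Fin (K + 1))) :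
    update (stackOf sub X) (.inr .work) l = stackOf sub { X with work := l } := by
  funext k; rcases k with p | a
  · rfl
  · cases a <;> rfl

@[simp] theorem update_stackOf_clock (l : List Unit) :
    update (stackOf sub X) (.inr .clock) l = stackOf sub { X with clock := l } := by
  funext k; rcases k with p | a
  · rfl
  · cases a <;> rfl

@[simp] theorem update_stackOf_scratch (l : List Bool) :
    update (stackOf sub X) (.inr .scratch) l = stackOf sub { X with scratch := l } := by
  funext k; rcases k with p | a
  · rfl
  · cases a <;> rfl

end Stacks

/-- A move of the submachine `M i`, as a move of the driver that goes on at the label `e` where the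
submachine would halt. -/
def liftStmt (i : Bool) (e : DLabel M C) : Stmt (M i).Γ (M i).Λ (M i).σ → DStmt M K C
  | .push k f q => .push (.inl ⟨i, k⟩) (fun s => f (s.1 i)) (liftStmt i e q)
  | .peek k f q =>
    .peek (.inl ⟨i, k⟩) (fun s x => (update s.1 i (f (s.1 i) x), s.2)) (liftStmt i e q)
  | .pop k f q =>
    .pop (.inl ⟨i, k⟩) (fun s x => (update s.1 i (f (s.1 i) x), s.2)) (liftStmt i e q)
  | .load f q => .load (fun s => (update s.1 i (f (s.1 i)), s.2)) (liftStmt i e q)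
  | .branch f q₁ q₂ => .branch (fun s => f (s.1 i)) (liftStmt i e q₁) (liftStmt i e q₂)
  | .goto f => .goto fun s => .inl ⟨i, f (s.1 i)⟩
  | .halt => .goto fun _ => e

/-- The configuration of the driver in which the submachine `M i` is in configuration `c`; halting
configurations correspond to the label `e`. -/
def embedCfg (i : Bool) (e : DLabel M C) (v : ∀ i, (M i).σ) (r : Registers K)
    (sub : ∀ i k, List ((M i).Γ k)) (X : Store K) (c : (M i).Cfg) : DCfg M K C :=
  ⟨some (c.l.elim e fun l => .inl ⟨i, l⟩), (update v i c.var, r), stackOf (update sub i c.stk) X⟩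

/-- Lifted moves simulate the moves of the submachine. -/
theorem stepAux_liftStmt (i : Bool) (e : DLabel M C) (v : ∀ i, (M i).σ) (r : Registers K)
    (sub : ∀ i k, List ((M i).Γ k)) (X : Store K) (q : Stmt (M i).Γ (M i).Λ (M i).σ)
    (s : (M i).σ) (S : ∀ k, List ((M i).Γ k)) :
    stepAux (liftStmt i e q) (update v i s, r) (stackOf (update sub i S) X)
      = embedCfg i e v r sub X (stepAux q s S) := by
  induction q generalizing s S with
  | push k f q ih => simpa [liftStmt] using ih _ _
  | peek k f q ih => simpa [liftStmt] using ih _ _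
  | pop k f q ih => simpa [liftStmt] using ih _ _
  | load f q ih => simpa [liftStmt] using ih _ _
  | branch f q₁ q₂ ih₁ ih₂ =>
    simp only [liftStmt, stepAux, Function.update_self]
    cases f s
    · simpa using ih₂ _ _
    · simpa using ih₁ _ _
  | goto f => simp [liftStmt, embedCfg]
  | halt => simp [liftStmt, embedCfg]

end Types

/-- A driver runs two submachines on its own input. In an initial phase, it copies its input to the
input stacks of both submachines, and puts `(n + 2) ^ K` coins on the clock stack, `n` being the
length of the input. It goes on at the label `entry`. When a submachine makes a binary choice, it
uses up a coin; when it halts, the driver continues at the label `exit i`. Everything else is up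
to the control program. -/
structure Driver (α β : Type) where
  /-- the submachines -/
  M : Bool → NTM α
  /-- the exponent in the number of coins -/
  K : ℕ
  /-- the labels of the control program -/
  C : Type
  [finC : Fintype C]
  /-- the label reached after the initial phase -/
  entry : DLabel M C
  /-- the labels reached when a submachine halts -/
  exit : Bool → DLabel M C
  /-- the control program -/
  prog : C → DStmt M K C
  /-- the second moves of the control program -/
  progAlt : C → Option (DStmt M K C)
  /-- the outcome -/
  out : DState M K → β

namespace Driver

variable {α β γ δ : Type} (D : Driver α β)

/-- The symbol that replaces the symbol in the register on the recursion stack: its predecessor. It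
is only used when the register holds a positive symbol. -/
def lower {K : ℕ} (s : Option (Fin (K + 1))) : Fin (K + 1) :=
  ⟨(s.getD 0 : ℕ) - 1, by omega⟩

/-- The program of the initial phase. The recursion stack initially holds the symbol `K`. The symbol
`0` stands for one coin, and the symbol `j + 1` for `n + 2` copies of the symbol `j`, which are
produced by a pass over the input. -/
def setup : Setup → DStmt D.M D.K D.C
  | .copy => .pop (.inr .inp) (fun s x => (s.1, x, s.2.2)) <|
      .branch (fun s => s.2.1.isSome)
        (.push (.inr .fwd) (fun s => s.2.1.getD false) <| .goto fun _ => .inr (.inl .copy))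
        (.push (.inr .work) (fun _ => Fin.last _) <| .goto fun _ => .inr (.inl .distribute))
  | .distribute => .pop (.inr .fwd) (fun s x => (s.1, x, s.2.2)) <|
      .branch (fun s => s.2.1.isSome)
        (.push (.inr .bwd) (fun s => s.2.1.getD false) <|
          .push (.inl ⟨false, (D.M false).k₀⟩)
            (fun s => (D.M false).inputAlphabet.symm (s.2.1.getD false)) <|
          .push (.inl ⟨true, (D.M true).k₀⟩)
            (fun s => (D.M true).inputAlphabet.symm (s.2.1.getD false)) <|
          .goto fun _ => .inr (.inl .distribute))
        (.goto fun _ => .inr (.inl .backward))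
  | .backward => .pop (.inr .bwd) (fun s x => (s.1, x, s.2.2)) <|
      .branch (fun s => s.2.1.isSome)
        (.push (.inr .fwd) (fun s => s.2.1.getD false) <| .goto fun _ => .inr (.inl .backward))
        (.goto fun _ => .inr (.inl .expand))
  | .expand => .pop (.inr .work) (fun s x => (s.1, s.2.1, x)) <|
      .branch (fun s => s.2.2.isSome)
        (.branch (fun s => s.2.2 == some 0)
          (.push (.inr .clock) (fun _ => ()) <| .goto fun _ => .inr (.inl .expand))
          (.goto fun _ => .inr (.inl .forward)))
        (.goto fun _ => D.entry)
  | .forward => .pop (.inr .fwd) (fun s x => (s.1, x, s.2.2)) <|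
      .branch (fun s => s.2.1.isSome)
        (.push (.inr .bwd) (fun s => s.2.1.getD false) <|
          .push (.inr .work) (fun s => lower s.2.2) <|
          .goto fun _ => .inr (.inl .forward))
        (.push (.inr .work) (fun s => lower s.2.2) <|
          .push (.inr .work) (fun s => lower s.2.2) <|
          .goto fun _ => .inr (.inl .backward))

/-- The program of the driver. -/
def program : DLabel D.M D.C → DStmt D.M D.K D.C
  | .inl p => if ((D.M p.1).alt p.2).isSome
      then .pop (.inr .clock) (fun s _ => s) (liftStmt p.1 (D.exit p.1) ((D.M p.1).m p.2))
      else liftStmt p.1 (D.exit p.1) ((D.M p.1).m p.2)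
  | .inr (.inl s) => D.setup s
  | .inr (.inr c) => D.prog c

/-- The second moves of the driver. -/
def programAlt : DLabel D.M D.C → Option (DStmt D.M D.K D.C)
  | .inl p => ((D.M p.1).alt p.2).map fun q =>
      .pop (.inr .clock) (fun s _ => s) (liftStmt p.1 (D.exit p.1) q)
  | .inr (.inl _) => none
  | .inr (.inr c) => D.progAlt c

/-- The machine that a driver describes. -/
def machine : NTM β where
  K := DStack D.M
  kFin := by
    have := fun i => (D.M i).kFin
    infer_instance
  k₀ := .inr .inp
  k₁ := .inr .inp
  Γ := DAlphabet D.M D.K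
  Λ := DLabel D.M D.C
  main := .inr (.inl .copy)
  ΛFin := by
    have := fun i => (D.M i).ΛFin
    have := D.finC
    infer_instance
  σ := DState D.M D.K
  initialState := (fun i => (D.M i).initialState, none, none)
  σFin := by
    have := fun i => (D.M i).σFin
    infer_instance
  Γk₀Fin := inferInstanceAs (Fintype Bool)
  m := D.program
  alt := D.programAlt
  inputAlphabet := Equiv.refl Bool
  outcome := D.out

/-- Started in the configuration `c`, the driver halts within `t` steps and has the tree `T` of
outcomes. -/
def Run (c : DCfg D.M D.K D.C) (T : CoinTree β) (t : ℕ) : Prop :=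
  D.machine.Unfolds (fun c => D.out c.var) c T t

variable {D}

theorem Run.mono {c : DCfg D.M D.K D.C} {T : CoinTree β} {t t' : ℕ} (h : D.Run c T t)
    (ht : t ≤ t') : D.Run c T t' :=
  NTM.Unfolds.mono h ht

theorem Run.halt (s : DState D.M D.K) (S : ∀ k, List (DAlphabet D.M D.K k)) (t : ℕ) :
    D.Run ⟨none, s, S⟩ (.leaf (D.out s)) t :=
  NTM.Unfolds.halt (N := D.machine) (ρ := fun c => D.out c.var) ⟨none, s, S⟩ t rfl

theorem Run.step {l : DLabel D.M D.C} {s : DState D.M D.K} {S : ∀ k, List (DAlphabet D.M D.K k)}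
    {T : CoinTree β} {t : ℕ} (ha : D.programAlt l = none)
    (h : D.Run (stepAux (D.program l) s S) T t) : D.Run ⟨some l, s, S⟩ T (t + 1) :=
  NTM.Unfolds.det (N := D.machine) (ρ := fun c => D.out c.var) ⟨some l, s, S⟩ l T t rfl ha h

/-- A step without choice, whose target is known to be `c'`. -/
theorem Run.step_to {l : DLabel D.M D.C} {s : DState D.M D.K}
    {S : ∀ k, List (DAlphabet D.M D.K k)} {c' : DCfg D.M D.K D.C} {T : CoinTree β} {t : ℕ}
    (ha : D.programAlt l = none) (hc : stepAux (D.program l) s S = c') (h : D.Run c' T t) :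
    D.Run ⟨some l, s, S⟩ T (t + 1) :=
  Run.step ha (hc ▸ h)

theorem Run.choice {l : DLabel D.M D.C} {s : DState D.M D.K}
    {S : ∀ k, List (DAlphabet D.M D.K k)} {T₁ T₂ : CoinTree β} {t : ℕ} {q : DStmt D.M D.K D.C}
    (ha : D.programAlt l = some q)
    (h₁ : D.Run (stepAux (D.program l) s S) T₁ t) (h₂ : D.Run (stepAux q s S) T₂ t) :
    D.Run ⟨some l, s, S⟩ (.node T₁ T₂) (t + 1) :=
  NTM.Unfolds.choice (N := D.machine) (ρ := fun c => D.out c.var) ⟨some l, s, S⟩ l q T₁ T₂ t rfl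
    ha h₁ h₂

/-- Simulation of a submachine: its computation tree `T` appears in that of the driver, with the
leaves replaced by what the driver does after the submachine has halted. -/
theorem Run.simulate {i : Bool} {ρ : (D.M i).Cfg → γ} {c : (D.M i).Cfg} {T : CoinTree γ}
    {t t' : ℕ} (h : (D.M i).Unfolds ρ c T t) (v : ∀ i, (D.M i).σ) (r : Registers D.K)
    (sub : ∀ i k, List ((D.M i).Γ k)) (X : Store D.K) (f : ℕ → γ → CoinTree β)
    (hf : ∀ c' : (D.M i).Cfg, T.Mem (ρ c') → ∀ coins : List Unit,
      coins.length ≤ X.clock.length →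
      D.Run ⟨some (D.exit i), (update v i c'.var, r),
        stackOf (update sub i c'.stk) { X with clock := coins }⟩ (f coins.length (ρ c')) t') :
    D.Run (embedCfg i (D.exit i) v r sub X c) (T.graft f X.clock.length) (t + t') := by
  induction h generalizing X with
  | halt c t hc =>
    have := hf c rfl X.clock le_rfl
    simp only [embedCfg, hc, Option.elim_none, CoinTree.graft]
    exact this.mono (by omega)
  | det c l T t hl ha _ ih =>
    have h := ih X hf
    rw [Nat.add_right_comm]
    simp only [embedCfg, hl, Option.elim_some]
    refine Run.step (by simp [programAlt, ha]) ?_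
    simp only [program, ha, Option.isSome_none, Bool.false_eq_true, if_false]
    rw [stepAux_liftStmt]
    exact h
  | choice c l q T₁ T₂ t hl ha _ _ ih₁ ih₂ =>
    have h₁ := ih₁ { X with clock := X.clock.tail } fun c' hc' coins hn =>
      hf c' (Or.inl hc') coins (hn.trans (by simp))
    have h₂ := ih₂ { X with clock := X.clock.tail } fun c' hc' coins hn =>
      hf c' (Or.inr hc') coins (hn.trans (by simp))
    simp only [List.length_tail] at h₁ h₂
    rw [Nat.add_right_comm]
    simp only [embedCfg, hl, Option.elim_some, CoinTree.graft]
    refine Run.choice (q := .pop (.inr .clock) (fun s _ => s) (liftStmt i (D.exit i) q))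
      (by simp [programAlt, ha]) ?_ ?_
    · simp only [program, ha, Option.isSome_some, if_true, stepAux, stackOf_clock,
        update_stackOf_clock]
      rw [stepAux_liftStmt]
      exact h₁
    · simp only [stepAux, stackOf_clock, update_stackOf_clock]
      rw [stepAux_liftStmt]
      exact h₂

end Driver

/-! ### The initial phase of a driver -/

namespace NTM

variable {α : Type} (N : NTM α)

theorem init_stk (w : List Bool) :
    (N.init w).stk = update (fun _ => []) N.k₀ (w.map N.inputAlphabet.symm) := by
  funext k
  by_cases hk : k = N.k₀
  · subst hk
    simp [init, Turing.initList]
  · simp [init, Turing.initList, hk]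

end NTM

namespace Driver

variable {α β : Type} {D : Driver α β} {T : CoinTree β} {t : ℕ} {v : ∀ i, (D.M i).σ}
  {sub : ∀ i k, List ((D.M i).Γ k)}

/-- A configuration at a label of the initial phase. -/
abbrev setupCfg (D : Driver α β) (l : Setup) (v : ∀ i, (D.M i).σ) (r : Registers D.K)
    (sub : ∀ i k, List ((D.M i).Γ k)) (X : Store D.K) : DCfg D.M D.K D.C :=
  ⟨some (.inr (.inl l)), (v, r), stackOf sub X⟩

/-- The input is moved to the stack `fwd`, and the recursion symbol `K` is pushed. -/
theorem Run.copy (w A : List Bool) (r : Registers D.K)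
    (h : ∀ r, D.Run (D.setupCfg .distribute v r sub
      { fwd := w.reverse ++ A, work := [Fin.last _] }) T t) :
    D.Run (D.setupCfg .copy v r sub { inp := w, fwd := A }) T (t + (w.length + 1)) := by
  induction w generalizing A r with
  | nil => exact Run.step rfl (by simpa [program, setup] using h _)
  | cons b w ih =>
    refine Run.step rfl ?_
    simpa [program, setup] using ih (b :: A) _ (by simpa using h)

/-- The submachines have their initial stacks with input `w`. -/
abbrev inputs (D : Driver α β) (w : List Bool) : ∀ i k, List ((D.M i).Γ k) :=
  fun i => ((D.M i).init w).stk

theorem inputs_cons (w : List Bool) (b : Bool) :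
    update (update (D.inputs w) false (update (D.inputs w false) (D.M false).k₀
        ((D.M false).inputAlphabet.symm b :: D.inputs w false (D.M false).k₀))) true
      (update (D.inputs w true) (D.M true).k₀
        ((D.M true).inputAlphabet.symm b :: D.inputs w true (D.M true).k₀))
      = D.inputs (b :: w) := by
  funext i
  cases i <;> simp [inputs, NTM.init_stk]

/-- The input is copied to the input stacks of the submachines. -/
theorem Run.distribute (w A B : List Bool) (W : List (Fin (D.K + 1))) (r : Registers D.K)
    (h : ∀ r, D.Run (D.setupCfg .backward v r (D.inputs (A.reverse ++ w))
      { bwd := A.reverse ++ B, work := W }) T t) :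
    D.Run (D.setupCfg .distribute v r (D.inputs w) { fwd := A, bwd := B, work := W }) T
      (t + (A.length + 1)) := by
  induction A generalizing w B r with
  | nil => exact Run.step rfl (by simpa [program, setup] using h _)
  | cons b A ih =>
    refine Run.step rfl ?_
    have := ih (b :: w) (b :: B) (some b, r.2) (by simpa using h)
    rw [← inputs_cons] at this
    simpa [program, setup] using this

/-- A pass over the input is undone. -/
theorem Run.backward (A B : List Bool) (W : List (Fin (D.K + 1))) (coins : List Unit)
    (r : Registers D.K)
    (h : ∀ r, D.Run (D.setupCfg .expand v r sub
      { fwd := B.reverse ++ A, work := W, clock := coins }) T t) :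
    D.Run (D.setupCfg .backward v r sub { fwd := A, bwd := B, work := W, clock := coins }) T
      (t + (B.length + 1)) := by
  induction B generalizing A r with
  | nil => exact Run.step rfl (by simpa [program, setup] using h _)
  | cons b B ih =>
    refine Run.step rfl ?_
    simpa [program, setup] using ih (b :: A) _ (by simpa using h)

/-- A pass over the input of length `n` replaces a recursion symbol by `n + 2` copies of its
predecessor. -/
theorem Run.forward (A B : List Bool) (W : List (Fin (D.K + 1))) (coins : List Unit)
    (b : Option Bool) (s : Option (Fin (D.K + 1)))
    (h : ∀ r, D.Run (D.setupCfg .backward v r sub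
      { bwd := A.reverse ++ B, work := List.replicate (A.length + 2) (lower s) ++ W,
        clock := coins }) T t) :
    D.Run (D.setupCfg .forward v (b, s) sub { fwd := A, bwd := B, work := W, clock := coins }) T
      (t + (A.length + 1)) := by
  induction A generalizing B b W with
  | nil => exact Run.step rfl (by simpa [program, setup] using h _)
  | cons a A ih =>
    refine Run.step rfl ?_
    have := ih (a :: B) (lower s :: W) (some a) (by
      simpa [List.replicate_succ', List.append_assoc] using h)
    simpa [program, setup] using this

theorem embedCfg_init {i : Bool} {e : DLabel D.M D.C}
    {v : ∀ i, (D.M i).σ} (hv : v i = (D.M i).initialState) (r : Registers D.K)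
    {sub : ∀ i k, List ((D.M i).Γ k)} {w : List Bool} (hs : sub i = D.inputs w i)
    (X : Store D.K) :
    embedCfg i e v r sub X ((D.M i).init w)
      = (⟨some (.inl ⟨i, (D.M i).main⟩), (v, r), stackOf sub X⟩ : DCfg D.M D.K D.C) := by
  have h₁ : update v i ((D.M i).init w).var = v := by
    rw [Function.update_eq_self_iff]; exact hv.symm
  have h₂ : update sub i ((D.M i).init w).stk = sub := by
    rw [Function.update_eq_self_iff]; exact hs.symm
  rw [embedCfg, h₁, h₂]
  rfl

/-- Simulation of a submachine from its initial configuration. -/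
theorem Run.simulate_init {γ : Type} {i : Bool} {ρ : (D.M i).Cfg → γ} {w : List Bool}
    {T : CoinTree γ} {t t' : ℕ} (h : (D.M i).Unfolds ρ ((D.M i).init w) T t)
    (hv : v i = (D.M i).initialState) (r : Registers D.K) (hs : sub i = D.inputs w i)
    (X : Store D.K) (f : ℕ → γ → CoinTree β)
    (hf : ∀ c' : (D.M i).Cfg, T.Mem (ρ c') → ∀ coins : List Unit,
      coins.length ≤ X.clock.length →
      D.Run ⟨some (D.exit i), (update v i c'.var, r),
        stackOf (update sub i c'.stk) { X with clock := coins }⟩ (f coins.length (ρ c')) t') :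
    D.Run ⟨some (.inl ⟨i, (D.M i).main⟩), (v, r), stackOf sub X⟩
      (T.graft f X.clock.length) (t + t') := by
  rw [← embedCfg_init (e := D.exit i) hv r hs X]
  exact Run.simulate h v r sub X f hf

/-- The number of steps that it takes to turn the recursion symbol `j` into `(n + 2) ^ j` coins. -/
noncomputable def expandTime : ℕ → Polynomial ℕ
  | 0 => 1
  | j + 1 => (Polynomial.X + 2) * expandTime j + 2 * Polynomial.X + 3

/-- The recursion symbol `j` is turned into `(n + 2) ^ j` coins. -/
theorem Run.expand (A : List Bool) (j : ℕ) (hj : j < D.K + 1) (W : List (Fin (D.K + 1)))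
    (coins : List Unit) (r : Registers D.K) {t : ℕ}
    (h : ∀ r coins', coins'.length = coins.length + (A.length + 2) ^ j →
      D.Run (D.setupCfg .expand v r sub { fwd := A, work := W, clock := coins' }) T t) :
    D.Run (D.setupCfg .expand v r sub { fwd := A, work := ⟨j, hj⟩ :: W, clock := coins }) T
      (t + (expandTime j).eval A.length) := by
  induction j generalizing W coins r t with
  | zero =>
    have e : t + (expandTime 0).eval A.length = t + 1 := by simp [expandTime]
    rw [e]
    refine Run.step rfl ?_
    have := h (r.1, some ⟨0, hj⟩) (() :: coins) (by simp)
    simpa [program, setup] using this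
  | succ j ih =>
    have hl : lower (some (⟨j + 1, hj⟩ : Fin (D.K + 1))) = ⟨j, by omega⟩ := rfl
    -- the `m` copies of the symbol `j` are processed one after the other
    have copies : ∀ (m : ℕ) (coins : List Unit) (r : Registers D.K),
        (∀ r coins', coins'.length = coins.length + m * (A.length + 2) ^ j →
          D.Run (D.setupCfg .expand v r sub { fwd := A, work := W, clock := coins' }) T t) →
        D.Run (D.setupCfg .expand v r sub
          { fwd := A, work := List.replicate m ⟨j, by omega⟩ ++ W, clock := coins }) T
          (t + m * (expandTime j).eval A.length) := by
      intro m
      induction m with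
      | zero => intro coins r h; simpa using h r coins
      | succ m ihm =>
        intro coins r h
        have := ih (by omega) (List.replicate m ⟨j, by omega⟩ ++ W) coins r
          (t := t + m * (expandTime j).eval A.length) fun r coins' hc =>
            ihm coins' r fun r coins'' hc' => h r coins'' (by rw [hc', hc]; ring)
        rw [Nat.add_mul, one_mul, ← Nat.add_assoc]
        exact this
    have h₁ := fun r => copies (A.length + 2) coins r fun r coins' hc =>
      h r coins' (by rw [hc, pow_succ'])
    have h₂ := fun r => Run.backward [] A.reverse _ _ r fun r => by simpa using h₁ r
    have h₃ := Run.forward A [] W coins r.1 (some ⟨j + 1, hj⟩) fun r => by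
      simpa [hl] using h₂ r
    have e : t + (expandTime (j + 1)).eval A.length = t + (A.length + 2) *
        (expandTime j).eval A.length + (A.length + 1) + (A.length + 1) + 1 := by
      simp [expandTime]; ring
    rw [e]
    refine Run.step rfl ?_
    have hne : ((⟨j + 1, hj⟩ : Fin (D.K + 1)) == 0) = false :=
      beq_eq_false_iff_ne.2 (by simp [Fin.ext_iff])
    simpa [program, setup, hne] using h₃

/-- The number of steps of the initial phase. -/
noncomputable def setupTime (K : ℕ) : Polynomial ℕ :=
  3 * Polynomial.X + 4 + expandTime K

/-- After the initial phase, both submachines are in their initial configuration with the input of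
the driver, and there are `(n + 2) ^ K` coins. -/
theorem hasTree_of_run (w : List Bool)
    (h : ∀ r coins A, coins.length = (w.length + 2) ^ D.K →
      D.Run ⟨some D.entry, (fun i => (D.M i).initialState, r),
        stackOf (D.inputs w) { fwd := A, clock := coins }⟩ T t) :
    D.machine.HasTree w T (t + (setupTime D.K).eval w.length) := by
  have h₁ : ∀ r coins A, coins.length = (w.length + 2) ^ D.K →
      D.Run (D.setupCfg .expand (fun i => (D.M i).initialState) r (D.inputs w)
        { fwd := A, clock := coins }) T (t + 1) := fun r coins A hc =>
    Run.step rfl (by simpa [program, setup] using h _ coins A hc)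
  have h₂ := fun r => Run.expand (D := D) (t := t + 1) w.reverse D.K (by omega) [] [] r
    fun r coins hc => h₁ r coins w.reverse (by simpa using hc)
  have h₃ := fun r => Run.backward (D := D) [] w _ _ r fun r => by simpa using h₂ r
  have h₄ := fun r => Run.distribute (D := D) [] w.reverse [] _ r fun r => by simpa using h₃ r
  have h₅ := Run.copy (D := D) w [] (none, none) fun r => by simpa [Fin.last] using h₄ r
  have e : D.machine.init w = D.setupCfg .copy (fun i => (D.M i).initialState) (none, none)
      (D.inputs []) { inp := w } := by
    have e₁ : (fun _ => [] : ∀ k, List (DAlphabet D.M D.K k)) = stackOf (D.inputs []) {} := by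
      funext k
      rcases k with p | a
      · simp [inputs, NTM.init_stk]
      · cases a <;> rfl
    have e₂ : w.map (Equiv.refl Bool).symm = w := by simp
    have hs : (D.machine.init w).stk = stackOf (D.inputs []) { inp := w } := by
      refine (NTM.init_stk D.machine w).trans (Eq.trans ?_
        (update_stackOf_inp (K := D.K) (D.inputs []) {} w))
      rw [← e₁]
      exact congrArg (update (fun _ => [] : ∀ k, List (DAlphabet D.M D.K k)) (.inr .inp)) e₂
    exact congrArg (fun S => (⟨_, _, S⟩ : DCfg D.M D.K D.C)) hs
  rw [NTM.HasTree, e]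
  refine Run.mono h₅ (le_of_eq ?_)
  simp [setupTime]
  ring

end Driver

theorem exists_pow_ge (q : Polynomial ℕ) :
    ∃ K : ℕ, ∀ n, q.eval n ≤ (n + 2) ^ K := by
  obtain ⟨K, h⟩ := exists_add_eq_X_add_two_pow q
  obtain ⟨p, h⟩ := h K le_rfl
  refine ⟨K, fun n => ?_⟩
  have := congrArg (Polynomial.eval n) h
  simp only [Polynomial.eval_add, Polynomial.eval_pow, Polynomial.eval_X,
    Polynomial.eval_ofNat] at this
  omega

/-! ### `UP ∩ coUP ⊆ postBPP_FP` -/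

/-- The control labels of the machine that guesses which of two machines accepts. -/
inductive GuessLabel
  | guess | done (i : Bool) | pad (i flag : Bool) | toss (i flag : Bool)

instance : Finite GuessLabel :=
  Finite.of_surjective (α := Fin 4 × Bool × Bool)
    (fun x => ![.guess, .done x.2.1, .pad x.2.1 x.2.2, .toss x.2.1 x.2.2] x.1) fun x => by
      rcases x with _ | i | ⟨i, b⟩ | ⟨i, b⟩
      exacts [⟨(0, true, true), rfl⟩, ⟨(1, i, true), rfl⟩, ⟨(2, i, b), rfl⟩, ⟨(3, i, b), rfl⟩]

/-- The control program of `guessDriver`. -/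
def guessProg (N : Bool → NTM Bool) (K : ℕ) : GuessLabel → DStmt N K GuessLabel
  | .guess => .goto fun _ => .inl ⟨false, (N false).main⟩
  | .done i => .goto fun s => .inr (.inr (.pad i ((N i).outcome (s.1 i))))
  | .pad i flag => .pop (.inr .clock) (fun s x => (s.1, x.map fun _ => false, s.2.2)) <|
      .branch (fun s => s.2.1.isSome) (.goto fun _ => .inr (.inr (.toss i flag)))
        (.load (fun s => (s.1, if flag then some i else none, s.2.2)) .halt)
  | .toss i flag => .goto fun _ => .inr (.inr (.pad i flag))

/-- Guess `i` and run `N i`. Afterwards toss all remaining coins. The outcome is `(1, i)` if `N i`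
has accepted and all these tosses gave `false`, and `(0, 0)` otherwise. The first register
is used for the outcome: `some i` means `(1, i)`. -/
noncomputable def guessDriver (N : Bool → NTM Bool) (K : ℕ) : Driver Bool (Bool × Bool) where
  M := N
  K := K
  C := GuessLabel
  finC := Fintype.ofFinite _
  entry := .inr (.inr .guess)
  exit i := .inr (.inr (.done i))
  prog := guessProg N K
  progAlt
    | .guess => some (.goto fun _ => .inl ⟨true, (N true).main⟩)
    | .toss i _ => some (.goto fun _ => .inr (.inr (.pad i false)))
    | _ => none
  out s := s.2.1.elim (false, false) fun i => (true, i)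

/-- The tree of the final tosses of `guessDriver`. -/
def guessTree (i : Bool) : Bool → ℕ → CoinTree (Bool × Bool)
  | flag, 0 => .leaf (if flag then (true, i) else (false, false))
  | flag, n + 1 => .node (guessTree i flag n) (guessTree i false n)

theorem uniform_guessTree (i flag : Bool) (n : ℕ) : (guessTree i flag n).Uniform n := by
  induction n generalizing flag with
  | zero => simp [guessTree, CoinTree.Uniform]
  | succ n ih => exact ⟨ih _, ih _⟩

open Classical in
/-- At most the path on which all tosses are `false` keeps the flag. -/
theorem count_guessTree (i flag : Bool) (n : ℕ) {A : Set (Bool × Bool)} (hA : (false, false) ∉ A) :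
    (guessTree i flag n).count A = if flag then (if (true, i) ∈ A then 1 else 0) else 0 := by
  induction n generalizing flag with
  | zero => cases flag <;> simp [guessTree, CoinTree.count, hA]
  | succ n ih => simp [guessTree, CoinTree.count, ih]

section Guess

variable (N : Bool → NTM Bool) (K : ℕ)

/-- The final tosses of `guessDriver`. -/
theorem run_pad (i flag : Bool) (coins : List Unit) (v : ∀ i, (N i).σ) (r : Registers K)
    (sub : ∀ i k, List ((N i).Γ k)) (X : Store K) :
    (guessDriver N K).Run ⟨some (.inr (.inr (.pad i flag))), (v, r),
      stackOf sub { X with clock := coins }⟩ (guessTree i flag coins.length)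
      (2 * coins.length + 1) := by
  induction coins generalizing flag r with
  | nil =>
    have e : stepAux (guessProg N K (.pad i flag)) (v, r) (stackOf sub { X with clock := [] }) =
        ⟨none, (v, if flag then some i else none, r.2), stackOf sub { X with clock := [] }⟩ := by
      simp [guessProg]
    refine Driver.Run.step_to rfl e ?_
    cases flag <;> exact Driver.Run.halt (D := guessDriver N K) _ _ _
  | cons a coins ih =>
    have e : stepAux (guessProg N K (.pad i flag)) (v, r)
        (stackOf sub { X with clock := a :: coins }) =
        ⟨some (.inr (.inr (.toss i flag))), (v, some false, r.2),
          stackOf sub { X with clock := coins }⟩ := by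
      simp [guessProg]
    exact Driver.Run.step_to rfl e
      (Driver.Run.choice (D := guessDriver N K) rfl (ih flag _) (ih false _))

/-- The computation tree of `guessDriver`, in terms of those of its submachines. -/
theorem guess_hasTree {w : List Bool} {T : Bool → CoinTree Bool} {t : ℕ}
    (h : ∀ i, (N i).HasTree w (T i) t) :
    (guessDriver N K).machine.HasTree w
      (.node ((T false).graft (fun n y => guessTree false y n) ((w.length + 2) ^ K))
        ((T true).graft (fun n y => guessTree true y n) ((w.length + 2) ^ K)))
      (t + (2 * (w.length + 2) ^ K + 2) + 1 + (Driver.setupTime K).eval w.length) := by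
  refine Driver.hasTree_of_run (D := guessDriver N K) w fun r coins A hc => ?_
  replace hc : coins.length = (w.length + 2) ^ K := hc
  have hsim : ∀ i, (guessDriver N K).Run ⟨some (.inl ⟨i, (N i).main⟩),
      (fun i => (N i).initialState, r), stackOf ((guessDriver N K).inputs w)
        { fwd := A, clock := coins }⟩
      ((T i).graft (fun n y => guessTree i y n) ((w.length + 2) ^ K))
      (t + (2 * (w.length + 2) ^ K + 2)) := by
    intro i
    rw [← hc]
    refine Driver.Run.simulate_init (D := guessDriver N K) (h i) rfl r rfl
      { fwd := A, clock := coins } (fun n y => guessTree i y n) fun c' _ coins' hn => ?_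
    have e : ∀ (x : (N i).σ) S, stepAux (guessProg N K (.done i))
        (update (fun i => (N i).initialState) i x, r) S =
        ⟨some (.inr (.inr (.pad i ((N i).outcome x)))),
          (update (fun i => (N i).initialState) i x, r), S⟩ := by
      simp [guessProg]
    replace hn : coins'.length ≤ coins.length := hn
    exact Driver.Run.mono (Driver.Run.step_to (D := guessDriver N K) rfl (e _ _)
      (run_pad N K i _ coins' _ r _ { fwd := A })) (by omega)
  exact Driver.Run.choice (D := guessDriver N K) rfl (hsim false) (hsim true)

end Guess

theorem UP_inter_coUP_subset : UP ∩ coUP ⊆ postBPP_FP := by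
  rintro L ⟨⟨N₁, ⟨p₁, hp₁⟩, hL₁⟩, ⟨N₀, ⟨p₀, hp₀⟩, hL₀⟩⟩
  obtain ⟨K, hK⟩ := exists_pow_ge (p₀ + p₁)
  simp only [Polynomial.eval_add] at hK
  let N : Bool → NTM Bool := fun i => cond i N₁ N₀
  have hN : ∀ i w, (N i).HaltsWithin ((p₀ + p₁).eval w.length) ((N i).init w) := by
    intro i w
    rw [Polynomial.eval_add]
    cases i
    · exact (hp₀ w).mono (by omega)
    · exact (hp₁ w).mono (by omega)
  choose T hT using fun w i => (hN i w).exists_unfolds fun c => (N i).outcome c.var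
  have hV := fun w => guess_hasTree N K (hT w)
  have hdepth : ∀ w i, (T w i).depth ≤ (w.length + 2) ^ K := fun w i =>
    (hT w i).depth_le.trans (by rw [Polynomial.eval_add]; exact hK _)
  have hunif : ∀ w, CoinTree.Uniform ((w.length + 2) ^ K + 1) (.node
      ((T w false).graft (fun n y => guessTree false y n) ((w.length + 2) ^ K))
      ((T w true).graft (fun n y => guessTree true y n) ((w.length + 2) ^ K))) := fun w =>
    ⟨CoinTree.uniform_graft _ (hdepth w false) fun m b => uniform_guessTree _ _ _,
      CoinTree.uniform_graft _ (hdepth w true) fun m b => uniform_guessTree _ _ _⟩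
  have hacc₀ : ∀ w, N₀.acc w = (T w false).count {true} := fun w =>
    NTM.HasTree.numPaths_eq (hT w false) _
  have hacc₁ : ∀ w, N₁.acc w = (T w true).count {true} := fun w =>
    NTM.HasTree.numPaths_eq (hT w true) _
  have hL₀' : ∀ w, (w ∈ L → N₀.acc w = 0) ∧ (w ∉ L → N₀.acc w = 1) := fun w =>
    ⟨fun h => (hL₀ w).2 fun h' => h' h, fun h => (hL₀ w).1 h⟩
  classical
  have hprob : ∀ w (A : Set (Bool × Bool)), (false, false) ∉ A →
      (guessDriver N K).machine.prob w A =
        ((N₀.acc w * (if (true, false) ∈ A then 1 else 0) +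
          N₁.acc w * (if (true, true) ∈ A then 1 else 0) : ℕ) : ℝ) /
            2 ^ ((w.length + 2) ^ K + 1) := by
    intro w A hA
    rw [(hV w).prob_eq (hunif w)]
    congr 2
    simp only [CoinTree.count, hacc₀, hacc₁]
    congr 1 <;>
    · refine CoinTree.count_graft _ (fun m b => ?_) _ _
      rw [count_guessTree _ _ _ hA]
      cases b <;> simp
  have hpost : ∀ w, probPost (guessDriver N K).machine w =
      ((N₀.acc w + N₁.acc w : ℕ) : ℝ) / 2 ^ ((w.length + 2) ^ K + 1) := fun w => by
    rw [probPost, hprob w _ (by simp)]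
    simp
  have hout : ∀ w, (guessDriver N K).machine.prob w {y | y.2 = true ∧ y.1 = true} =
      (N₁.acc w : ℝ) / 2 ^ ((w.length + 2) ^ K + 1) := fun w => by
    rw [hprob w _ (by simp)]
    simp
  have hcond : ∀ w, probOutGivenPost (guessDriver N K).machine w =
      (N₁.acc w : ℝ) / (N₀.acc w + N₁.acc w : ℕ) := fun w => by
    have := hpost w
    rw [probPost] at this
    rw [probOutGivenPost, this, hout, div_div_div_cancel_right₀ (by positivity)]
  refine ⟨(guessDriver N K).machine,
    ⟨(p₀ + p₁) + (2 * (Polynomial.X + 2) ^ K + 2) + 1 + Driver.setupTime K, fun w => ?_⟩,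
    fun w => ⟨(w.length + 2) ^ K + 1, fun x hx => ?_⟩, fun _ => 1, one_mem_FP, fun _ => one_pos,
    (Polynomial.X + 2) ^ K + 1, 1, one_pos, fun w => ⟨?_, fun hw => ?_, fun hw => ?_⟩⟩
  · have := (hV w).haltsWithin
    simpa using this
  · rw [(hV w).paths_eq] at hx
    exact (CoinTree.uniform_iff _ _).1 (hunif w) x hx
  · rw [hpost]
    by_cases hw : w ∈ L
    · simp [(hL₁ w).1 hw, (hL₀' w).1 hw]
    · simp [(hL₁ w).2 hw, (hL₀' w).2 hw]
  · rw [hcond, (hL₁ w).1 hw, (hL₀' w).1 hw]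
    norm_num
  · rw [hcond, (hL₁ w).2 hw, (hL₀' w).2 hw]
    norm_num

/-! ### Approximate division by counting -/

/-- The complete tree with `n` levels, all leaves accepting. -/
def acceptTree : ℕ → CoinTree Bool
  | 0 => .leaf true
  | n + 1 => .node (acceptTree n) (acceptTree n)

theorem count_acceptTree (n : ℕ) : (acceptTree n).count {true} = 2 ^ n := by
  induction n with
  | zero => simp [acceptTree, CoinTree.count]
  | succ n ih => simp [acceptTree, CoinTree.count, ih, pow_succ]; omega

/-- Toss the bits of a number `x` of the same length as `l`, least significant bit first, and
compare it with `l`. At the end, `ge` says whether `x` is at least the number with binary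
digits `l`, and `z` says whether `x` is zero, if both are `true` initially. -/
def scanTree (next : Bool → Bool → CoinTree Bool) : List Bool → Bool → Bool → CoinTree Bool
  | [], ge, z => next ge z
  | b :: l, ge, z => .node (scanTree next l (!b && ge) z) (scanTree next l (!b || ge) false)

theorem count_scanTree_const (T : CoinTree Bool) (A : Set Bool) (l : List Bool) (ge z : Bool) :
    (scanTree (fun _ _ => T) l ge z).count A = 2 ^ l.length * T.count A := by
  induction l generalizing ge z with
  | nil => simp [scanTree]
  | cons b l ih => simp [scanTree, CoinTree.count, ih, pow_succ]; ring

/-- Tossing `x`, the mode `ge` is reached for `2 ^ k - f` values of `x`, where `f` is the number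
with digits `l`, and the branch for `x = 0 < f` is reached exactly once. -/
theorem count_scanTree {next : Bool → Bool → CoinTree Bool} {A : Set Bool} {a b : ℕ}
    (h₁ : ∀ z, (next true z).count A = a) (h₂ : (next false true).count A = b)
    (h₃ : (next false false).count A = 0) (l : List Bool) (ge z : Bool) :
    (scanTree next l ge z).count A + (bitsVal l + if ge then 0 else 1) * a =
      2 ^ l.length * a + if z ∧ (0 < bitsVal l ∨ ge = false) then b else 0 := by
  induction l generalizing ge z with
  | nil => cases ge <;> cases z <;> simp [scanTree, bitsVal, h₁, h₂, h₃, add_comm]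
  | cons c l ih =>
    have e₁ := ih (!c && ge) z
    have e₂ := ih (!c || ge) false
    simp only [scanTree, CoinTree.count, bitsVal, List.length_cons, pow_succ]
    cases c
    · simp only [Bool.not_false, Bool.true_and, Bool.true_or, if_true, Bool.false_eq_true,
        false_and, if_false, Bool.toNat_false, zero_add, add_zero] at e₁ e₂ ⊢
      have : 0 < 2 * bitsVal l ↔ 0 < bitsVal l := by omega
      simp only [this]
      linear_combination e₁ + e₂
    · simp only [Bool.not_true, Bool.false_and, Bool.false_or, Bool.false_eq_true,
        false_and, if_false, Bool.toNat_true, or_true, and_true, add_zero] at e₁ e₂ ⊢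
      have : 0 < 1 + 2 * bitsVal l := by omega
      simp only [this, true_or, and_true]
      linear_combination e₁ + e₂

/-- The tree of `r` rounds, in each of which a number `x` is tossed with as many bits as the
divisor `l`, followed by the toss of all remaining coins, when there are `n` coins. As long as `chk`
is `true`, the round is passed if `x` is at least the divisor, and if `x = 0`, then all
later rounds are passed unconditionally. One has to leave the checking mode eventually. -/
def roundTree (l : List Bool) : ℕ → Bool → ℕ → CoinTree Bool
  | 0, chk, n => if chk then .leaf false else acceptTree n
  | r + 1, chk, n => scanTree (fun ge z =>
      if chk && !ge && !z then .leaf false else roundTree l r (chk && ge) (n - l.length))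
    l true true

theorem count_roundTree_false (l : List Bool) (r m : ℕ) :
    (roundTree l r false (m + r * l.length)).count {true} = 2 ^ (m + r * l.length) := by
  induction r with
  | zero => simp [roundTree, count_acceptTree]
  | succ r ih =>
    have e : m + (r + 1) * l.length - l.length = m + r * l.length := by
      rw [Nat.add_mul, one_mul]; omega
    simp only [roundTree, Bool.false_and, Bool.false_eq_true, if_false, e]
    rw [count_scanTree_const, ih, ← pow_add]
    congr 1
    ring

/-- The number of accepting leaves is `2 ^ n` times the partial sum of a geometric series that
converges to the inverse of the divisor. -/
theorem count_roundTree_true {l : List Bool} (hl : 0 < bitsVal l) {v : ℕ}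
    (hv : v + bitsVal l = 2 ^ l.length) (r m : ℕ) :
    bitsVal l * (roundTree l r true (m + r * l.length)).count {true} + 2 ^ m * v ^ r =
      2 ^ (m + r * l.length) := by
  induction r with
  | zero => simp [roundTree, CoinTree.count]
  | succ r ih =>
    have e : m + (r + 1) * l.length - l.length = m + r * l.length := by
      rw [Nat.add_mul, one_mul]; omega
    have h := count_scanTree (A := {true}) (next := fun ge z =>
      if true && !ge && !z then .leaf false
      else roundTree l r (true && ge) (m + (r + 1) * l.length - l.length))
      (a := (roundTree l r true (m + r * l.length)).count {true}) (b := 2 ^ (m + r * l.length))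
      (fun z => by simp [e]) (by simp [e, count_roundTree_false])
      (by simp [CoinTree.count]) l true true
    simp only [if_true, add_zero, hl, true_or, and_self] at h
    have hc : (roundTree l (r + 1) true (m + (r + 1) * l.length)).count {true} =
        v * (roundTree l r true (m + r * l.length)).count {true} + 2 ^ (m + r * l.length) := by
      simp only [roundTree]
      rw [← hv] at h
      linarith [h]
    have hp : 2 ^ (m + (r + 1) * l.length) = (v + bitsVal l) * 2 ^ (m + r * l.length) := by
      rw [hv, ← pow_add]; congr 1; ring
    rw [hc, hp, pow_succ]
    linear_combination v * ih

/-- If `c / 2 ^ (m + J * k)` is the partial sum of the first `J` terms of the geometric series for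
`1 / f`, where `2 ^ (k - 1) ≤ f ≤ 2 ^ k`, then it approximates `1 / f` from below
with relative error at most `2 ^ (-J)`. -/
theorem approx_div {a c f v t q p k m J : ℕ} (hf : 0 < f) (hv : v + f = 2 ^ k)
    (hk : 2 ^ k ≤ 2 * f) (hc : f * c + 2 ^ m * v ^ J = 2 ^ (m + J * k))
    (hp : p + q = m + J * k + t) :
    ((a * c : ℕ) : ℝ) / 2 ^ p ≤ (a / 2 ^ t : ℝ) / (f / 2 ^ q) ∧
      (a / 2 ^ t : ℝ) / (f / 2 ^ q) * (1 - (1 / 2) ^ J) ≤ ((a * c : ℕ) : ℝ) / 2 ^ p := by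
  have hf' : (0 : ℝ) < f := by exact_mod_cast hf
  set u : ℝ := v / 2 ^ k with hu
  have hu0 : 0 ≤ u := by positivity
  have hu1 : u ≤ 1 / 2 := by
    rw [hu, div_le_iff₀ (by positivity)]
    have h : 2 * v ≤ 2 ^ k := by omega
    have h' : (2 : ℝ) * v ≤ 2 ^ k := by exact_mod_cast h
    linarith
  have huJ : u ^ J ≤ (1 / 2) ^ J := pow_le_pow_left₀ hu0 hu1 J
  have hc' : (f : ℝ) * c = 2 ^ (m + J * k) * (1 - u ^ J) := by
    have h : (f : ℝ) * c + 2 ^ m * v ^ J = 2 ^ (m + J * k) := by exact_mod_cast hc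
    have h2 : (2 : ℝ) ^ m * v ^ J = 2 ^ (m + J * k) * u ^ J := by
      rw [hu, div_pow, ← pow_mul, pow_add, mul_comm J k]
      field_simp
    linarith
  have hp' : (2 : ℝ) ^ p * 2 ^ q = 2 ^ (m + J * k) * 2 ^ t := by rw [← pow_add, hp, pow_add]
  have key : ((a * c : ℕ) : ℝ) / 2 ^ p = (a / 2 ^ t : ℝ) / (f / 2 ^ q) * (1 - u ^ J) := by
    push_cast
    rw [div_div_div_eq, div_mul_eq_mul_div, div_eq_div_iff (by positivity) (by positivity)]
    calc (a : ℝ) * c * (2 ^ t * f) = a * 2 ^ t * (f * c) := by ring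
      _ = a * (2 ^ (m + J * k) * 2 ^ t) * (1 - u ^ J) := by rw [hc']; ring
      _ = _ := by rw [← hp']; ring
  have hR : 0 ≤ (a / 2 ^ t : ℝ) / (f / 2 ^ q) := by positivity
  rw [key]
  constructor
  · exact mul_le_of_le_one_right hR (by linarith [pow_nonneg hu0 J])
  · exact mul_le_mul_of_nonneg_left (by linarith) hR

/-! ### `postBPP_FP ⊆ WAPP` -/

/-- The control labels of the machine that divides by counting. -/
inductive DivLabel (J : ℕ)
  | check | pad | padToss
  | rewind (r : Fin (J + 1)) (chk : Bool)
  | scan (r : Fin (J + 1)) (chk ge z : Bool)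
  | toss (r : Fin (J + 1)) (chk ge z b : Bool)

instance (J : ℕ) : Finite (DivLabel J) :=
  Finite.of_surjective (α := Fin 6 × Fin (J + 1) × Bool × Bool × Bool × Bool)
    (fun x => ![.check, .pad, .padToss, .rewind x.2.1 x.2.2.1,
      .scan x.2.1 x.2.2.1 x.2.2.2.1 x.2.2.2.2.1,
      .toss x.2.1 x.2.2.1 x.2.2.2.1 x.2.2.2.2.1 x.2.2.2.2.2] x.1) fun x => by
      rcases x with _ | _ | _ | ⟨r, i⟩ | ⟨r, i, j, k⟩ | ⟨r, i, j, k, b⟩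
      exacts [⟨(0, 0, true, true, true, true), rfl⟩, ⟨(1, 0, true, true, true, true), rfl⟩,
        ⟨(2, 0, true, true, true, true), rfl⟩, ⟨(3, r, i, true, true, true), rfl⟩,
        ⟨(4, r, i, j, k, true), rfl⟩, ⟨(5, r, i, j, k, b), rfl⟩]

section Div

variable (M : Bool → NTM (Bool × Bool)) (e : (M false).Γ (M false).k₁ ≃ Bool) (K J : ℕ)

/-- The control program of `divDriver`. -/
def divProg : DivLabel J → DStmt M K (DivLabel J)
  | .check => .branch (fun s => (M true).outcome (s.1 true) == (true, true))
      (.goto fun _ => .inr (.inr (.rewind (Fin.last J) true)))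
      (.load (fun s => (s.1, none, s.2.2)) .halt)
  | .rewind r chk => .pop (.inr .scratch) (fun s x => (s.1, x, s.2.2)) <|
      .branch (fun s => s.2.1.isSome)
        (.push (.inl ⟨false, (M false).k₁⟩) (fun s => e.symm (s.2.1.getD false)) <|
          .goto fun _ => .inr (.inr (.rewind r chk)))
        (if r.1 = 0 then
          if chk then .load (fun s => (s.1, none, s.2.2)) .halt else .goto fun _ => .inr (.inr .pad)
        else .goto fun _ => .inr (.inr (.scan ⟨r.1 - 1, by omega⟩ chk true true)))
  | .scan r chk ge z => .pop (.inl ⟨false, (M false).k₁⟩) (fun s x => (s.1, x.map e, s.2.2)) <|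
      .branch (fun s => s.2.1.isSome)
        (.push (.inr .scratch) (fun s => s.2.1.getD false) <|
          .pop (.inr .clock) (fun s _ => s) <|
          .goto fun s => .inr (.inr (.toss r chk ge z (s.2.1.getD false))))
        (if chk && !ge && !z then .load (fun s => (s.1, none, s.2.2)) .halt
        else .goto fun _ => .inr (.inr (.rewind r (chk && ge))))
  | .toss r chk ge z b => .goto fun _ => .inr (.inr (.scan r chk (!b && ge) z))
  | .pad => .pop (.inr .clock) (fun s x => (s.1, x.map fun _ => false, s.2.2)) <|
      .branch (fun s => s.2.1.isSome) (.goto fun _ => .inr (.inr .padToss))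
        (.load (fun s => (s.1, some true, s.2.2)) .halt)
  | .padToss => .goto fun _ => .inr (.inr .pad)

/-- Run `M false`, which writes the binary expansion of a number `f`, and then `M true`. If the
outcome of the latter is `(1, 1)`, go through `J` rounds of comparing random numbers with `f`, as
described by `roundTree`, and toss the remaining coins. -/
noncomputable def divDriver : Driver (Bool × Bool) Bool where
  M := M
  K := K
  C := DivLabel J
  finC := Fintype.ofFinite _
  entry := .inl ⟨false, (M false).main⟩
  exit i := if i then .inr (.inr .check) else .inl ⟨true, (M true).main⟩
  prog := divProg M e K J
  progAlt
    | .toss r chk ge _ b => some (.goto fun _ => .inr (.inr (.scan r chk (!b || ge) false)))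
    | .padToss => some (.goto fun _ => .inr (.inr .pad))
    | _ => none
  out s := s.2.1 == some true

variable (v : ∀ i, (M i).σ) (sub : ∀ i k, List ((M i).Γ k)) (X : Store K)

/-- A configuration at a control label of `divDriver`, with the digits `l` on the output stack
of `M false`. -/
abbrev divCfg (c : DivLabel J) (r : Registers K) (l : List Bool) (X : Store K) :
    DCfg M K (DivLabel J) :=
  ⟨some (.inr (.inr c)), (v, r),
    stackOf (update sub false (update (sub false) (M false).k₁ (l.map e.symm))) X⟩

/-- The toss of all remaining coins. -/
theorem run_accept (l : List Bool) (coins : List Unit) (r : Registers K) :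
    (divDriver M e K J).Run (divCfg M e K J v sub .pad r l { X with clock := coins })
      (acceptTree coins.length) (2 * coins.length + 1) := by
  induction coins generalizing r with
  | nil =>
    have h : ∀ S, stepAux (divProg M e K J .pad) (v, r) (stackOf S { X with clock := [] }) =
        ⟨none, (v, some true, r.2), stackOf S { X with clock := [] }⟩ := by
      simp [divProg]
    exact Driver.Run.step_to rfl (h _) (Driver.Run.halt (D := divDriver M e K J) _ _ _)
  | cons a coins ih =>
    have h : ∀ S, stepAux (divProg M e K J .pad) (v, r) (stackOf S { X with clock := a :: coins }) =
        ⟨some (.inr (.inr .padToss)), (v, some false, r.2),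
          stackOf S { X with clock := coins }⟩ := by
      simp [divProg]
    exact Driver.Run.step_to rfl (h _)
      (Driver.Run.choice (D := divDriver M e K J) rfl (ih _) (ih _))

/-- The scratch stack is moved back to the output stack of `M false`. -/
theorem run_rewind (i : Fin (J + 1)) (chk : Bool) (l g : List Bool) (r : Registers K)
    {T : CoinTree Bool} {t : ℕ}
    (h : ∀ r, (divDriver M e K J).Run (divCfg M e K J v sub (.rewind i chk) r (g.reverse ++ l)
      { X with scratch := [] }) T t) :
    (divDriver M e K J).Run (divCfg M e K J v sub (.rewind i chk) r l { X with scratch := g }) T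
      (t + g.length) := by
  induction g generalizing l r with
  | nil => exact h r
  | cons b g ih =>
    have hs : stepAux (divProg M e K J (.rewind i chk)) (v, r)
        (stackOf (update sub false (update (sub false) (M false).k₁ (l.map e.symm)))
          { X with scratch := b :: g }) =
        divCfg M e K J v sub (.rewind i chk) (some b, r.2) (b :: l) { X with scratch := g } := by
      simp [divProg]
    exact Driver.Run.step_to rfl hs (ih (b :: l) _ (by simpa using h))

/-- One pass over the digits of the divisor, which end up reversed on the scratch stack. -/
theorem run_scan (i : Fin (J + 1)) (chk ge z : Bool) (l g : List Bool) (coins : List Unit)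
    (r : Registers K) {next : Bool → Bool → CoinTree Bool} {t : ℕ}
    (h : ∀ r ge z, (divDriver M e K J).Run (divCfg M e K J v sub (.scan i chk ge z) r []
      { X with scratch := l.reverse ++ g, clock := coins.drop l.length }) (next ge z) t) :
    (divDriver M e K J).Run (divCfg M e K J v sub (.scan i chk ge z) r l
      { X with scratch := g, clock := coins }) (scanTree next l ge z) (t + 2 * l.length) := by
  induction l generalizing ge z g coins r with
  | nil => exact h r ge z
  | cons b l ih =>
    have hs : stepAux (divProg M e K J (.scan i chk ge z)) (v, r)
        (stackOf (update sub false (update (sub false) (M false).k₁ ((b :: l).map e.symm)))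
          { X with scratch := g, clock := coins }) =
        divCfg M e K J v sub (.toss i chk ge z b) (some b, r.2) l
          { X with scratch := b :: g, clock := coins.tail } := by
      simp [divProg]
    have ih' := fun ge z => ih ge z (b :: g) coins.tail (some b, r.2) (by simpa using h)
    exact Driver.Run.step_to rfl hs
      (Driver.Run.choice (D := divDriver M e K J) rfl (ih' _ _) (ih' _ _))

theorem run_rounds (i : ℕ) (hi : i < J + 1) (chk : Bool) (l : List Bool) (coins : List Unit)
    (r : Registers K) :
    (divDriver M e K J).Run (divCfg M e K J v sub (.rewind ⟨i, hi⟩ chk) r l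
      { X with scratch := [], clock := coins }) (roundTree l i chk coins.length)
      (i * (3 * l.length + 2) + (2 * coins.length + 2)) := by
  induction i generalizing chk coins r with
  | zero =>
    cases chk
    · have hs : ∀ S, stepAux (divProg M e K J (.rewind ⟨0, hi⟩ false)) (v, r)
          (stackOf S { X with scratch := [], clock := coins }) =
          ⟨some (.inr (.inr .pad)), (v, none, r.2),
            stackOf S { X with scratch := [], clock := coins }⟩ := by
        simp [divProg]
      exact Driver.Run.mono (Driver.Run.step_to (D := divDriver M e K J) rfl (hs _)
        (run_accept M e K J v sub { X with scratch := [] } l coins (none, r.2))) (by omega)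
    · have hs : ∀ S, stepAux (divProg M e K J (.rewind ⟨0, hi⟩ true)) (v, r)
          (stackOf S { X with scratch := [], clock := coins }) =
          ⟨none, (v, none, r.2), stackOf S { X with scratch := [], clock := coins }⟩ := by
        simp [divProg]
      exact Driver.Run.mono (Driver.Run.step_to (D := divDriver M e K J) (t := 0) rfl (hs _)
        (Driver.Run.halt (D := divDriver M e K J) _ _ _)) (by omega)
  | succ i ih =>
    have hs : ∀ S, stepAux (divProg M e K J (.rewind ⟨i + 1, hi⟩ chk)) (v, r)
        (stackOf S { X with scratch := [], clock := coins }) =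
        ⟨some (.inr (.inr (.scan ⟨i, by omega⟩ chk true true))), (v, none, r.2),
          stackOf S { X with scratch := [], clock := coins }⟩ := by
      simp [divProg]
    have hend : ∀ r ge z, (divDriver M e K J).Run
        (divCfg M e K J v sub (.scan ⟨i, by omega⟩ chk ge z) r []
          { X with scratch := l.reverse ++ [], clock := coins.drop l.length })
        (if chk && !ge && !z then .leaf false
          else roundTree l i (chk && ge) (coins.length - l.length))
        (i * (3 * l.length + 2) + (2 * coins.length + 2) + l.length + 1) := by
      intro r ge z
      by_cases hrej : (chk && !ge && !z) = true
      · have hs : stepAux (divProg M e K J (.scan ⟨i, by omega⟩ chk ge z)) (v, r)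
            (stackOf (update sub false
              (update (sub false) (M false).k₁ (([] : List Bool).map e.symm)))
              { X with scratch := l.reverse ++ [], clock := coins.drop l.length }) =
            ⟨none, (v, none, r.2),
              stackOf (update sub false (update (sub false) (M false).k₁ []))
              { X with scratch := l.reverse ++ [], clock := coins.drop l.length }⟩ := by
          simp [divProg, hrej]
        rw [if_pos hrej]
        exact Driver.Run.step_to rfl hs (Driver.Run.halt (D := divDriver M e K J) _ _ _)
      · have hs : stepAux (divProg M e K J (.scan ⟨i, by omega⟩ chk ge z)) (v, r)
            (stackOf (update sub false
              (update (sub false) (M false).k₁ (([] : List Bool).map e.symm)))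
              { X with scratch := l.reverse ++ [], clock := coins.drop l.length }) =
            divCfg M e K J v sub (.rewind ⟨i, by omega⟩ (chk && ge)) (none, r.2) []
              { X with scratch := l.reverse, clock := coins.drop l.length } := by
          simp [divProg, hrej]
        rw [if_neg hrej]
        refine Driver.Run.step_to rfl hs ?_
        have := run_rewind M e K J v sub { X with clock := coins.drop l.length } ⟨i, by omega⟩
          (chk && ge) [] l.reverse (none, r.2) fun r => by
            have := ih (by omega) (chk && ge) (coins.drop l.length) r
            simp only [List.length_drop] at this
            simpa using this
        exact this.mono (by simp only [List.length_reverse]; omega)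
    exact Driver.Run.mono (Driver.Run.step_to (D := divDriver M e K J) rfl (hs _)
      (run_scan M e K J v sub X ⟨i, by omega⟩ chk true true l [] coins (none, r.2) hend))
      (by rw [Nat.add_mul]; omega)

open Classical in
theorem run_check {l : List Bool} (hsub : sub false (M false).k₁ = l.map e.symm)
    (coins : List Unit) (r : Registers K) :
    (divDriver M e K J).Run ⟨some (.inr (.inr .check)), (v, r),
        stackOf sub { X with scratch := [], clock := coins }⟩
      (if (M true).outcome (v true) = (true, true) then roundTree l J true coins.length
        else .leaf false) (J * (3 * l.length + 2) + (2 * coins.length + 2) + 1) := by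
  split_ifs with h
  · have hs : stepAux (divProg M e K J .check) (v, r)
        (stackOf sub { X with scratch := [], clock := coins }) =
        divCfg M e K J v sub (.rewind (Fin.last J) true) r l
          { X with scratch := [], clock := coins } := by
      simp [divProg, h, ← hsub]
    exact Driver.Run.step_to rfl hs (run_rounds M e K J v sub X J (by omega) true l coins r)
  · have hs : stepAux (divProg M e K J .check) (v, r)
        (stackOf sub { X with scratch := [], clock := coins }) =
        ⟨none, (v, none, r.2), stackOf sub { X with scratch := [], clock := coins }⟩ := by
      simp [divProg, beq_eq_false_iff_ne.2 h]
    exact Driver.Run.step_to rfl hs (Driver.Run.halt (D := divDriver M e K J) _ _ _)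

open Classical in
/-- The computation tree of `divDriver`, if `M false` halts with the digits `l` on its output stack:
the rounds of `roundTree` are appended to the paths of `M true` with outcome `(1, 1)`. -/
theorem div_hasTree {w l : List Bool} {T : CoinTree (Bool × Bool)} {t₀ t₁ : ℕ}
    {cf : (M false).Cfg} (hcf : cf.stk (M false).k₁ = l.map e.symm)
    (h₀ : (M false).Unfolds id ((M false).init w) (.leaf cf) t₀)
    (h₁ : (M true).HasTree w T t₁) :
    (divDriver M e K J).machine.HasTree w
      (T.graft (fun n y => if y = (true, true) then roundTree l J true n else .leaf false)
        ((w.length + 2) ^ K))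
      (t₀ + (t₁ + (J * (3 * l.length + 2) + (2 * (w.length + 2) ^ K + 3))) +
        (Driver.setupTime K).eval w.length) := by
  refine Driver.hasTree_of_run (D := divDriver M e K J) w fun r coins A hc => ?_
  replace hc : coins.length = (w.length + 2) ^ K := hc
  rw [← hc]
  refine Driver.Run.simulate_init (D := divDriver M e K J) (i := false) h₀ rfl r rfl
    { fwd := A, clock := coins } (fun n _ => T.graft (fun n y => if y = (true, true) then
      roundTree l J true n else .leaf false) n) fun c' hc' coins₁ hn₁ => ?_
  obtain rfl : cf = c' := hc'
  replace hn₁ : coins₁.length ≤ coins.length := hn₁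
  refine Driver.Run.simulate_init (D := divDriver M e K J) (i := true) h₁
    (by simp) r (by simp) { fwd := A, clock := coins₁ } (fun n y => if y = (true, true) then
      roundTree l J true n else .leaf false) fun c' _ coins₂ hn₂ => ?_
  replace hn₂ : coins₂.length ≤ coins₁.length := hn₂
  exact Driver.Run.mono (run_check M e K J
    (update (update (fun i => (M i).initialState) false cf.var) true c'.var)
    (update (update ((divDriver M e K J).inputs w) false cf.stk) true c'.stk) { fwd := A }
    hcf coins₂ r) (by omega)

end Div

theorem haltList_stk (tm : Turing.FinTM2) (s : List (tm.Γ tm.k₁)) :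
    (Turing.haltList tm s).stk tm.k₁ = s := by
  simp [Turing.haltList]

theorem postBPP_FP_subset : postBPP_FP ⊆ WAPP := by
  rintro L ⟨V, ⟨pV, hpV⟩, hbal, f, ⟨F⟩, hf, q, ε, hε, hL⟩
  obtain ⟨J, hJ⟩ := exists_pow_lt_of_lt_one (show 0 < ε / (2 * (1 + ε)) by positivity)
    (show (1 / 2 : ℝ) < 1 by norm_num)
  -- the number of coins is `p + q`, which suffices for `V` and `J` passes over the digits of `f w`
  obtain ⟨K, hK⟩ := exists_add_eq_X_add_two_pow (q + (pV + (J : Polynomial ℕ) * (q + 1)))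
  obtain ⟨p₀, hp₀⟩ := hK K le_rfl
  set p : Polynomial ℕ := p₀ + (pV + (J : Polynomial ℕ) * (q + 1)) with hp
  have hcoins : ∀ n, (n + 2) ^ K = p₀.eval n + (pV.eval n + J * (q.eval n + 1)) + q.eval n := by
    intro n
    have := congrArg (Polynomial.eval n) hp₀
    simp at this
    omega
  choose T hT using fun w => (hpV w).exists_unfolds fun c => V.outcome c.var
  choose t ht using hbal
  have hunif : ∀ w, (T w).Uniform (t w) := fun w =>
    (CoinTree.uniform_iff _ _).2 (by rw [← NTM.HasTree.paths_eq (hT w)]; exact ht w)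
  have htp : ∀ w, t w ≤ pV.eval w.length := fun w =>
    (hunif w).depth_eq.symm.trans_le (hT w).depth_le
  have hprob : ∀ w A, V.prob w A = (T w).count A / 2 ^ t w := fun w A =>
    NTM.HasTree.prob_eq (hT w) (hunif w) A
  let M : Bool → NTM (Bool × Bool) := fun i =>
    bif i then V else NTM.ofFinTM2 F.tm F.inputAlphabet (false, false)
  let l : List Bool → List Bool := fun w => Computability.encodeNat (f w)
  have hl : ∀ w, bitsVal (l w) = f w ∧ 2 ^ (l w).length ≤ 2 * f w := fun w => encodeNat_spec (hf w)
  -- `f w` has at most `q + 1` digits, since `f w / 2 ^ q` is a probability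
  have hlen : ∀ w, (l w).length ≤ q.eval w.length + 1 := by
    intro w
    have h₁ := (hL w).1
    rw [probPost, hprob] at h₁
    have h₂ : ((T w).count {y | y.1 = true} : ℝ) / 2 ^ t w ≤ 1 := by
      rw [div_le_one (by positivity)]
      exact_mod_cast (hunif w).count_le _
    rw [h₁, div_le_one (by positivity)] at h₂
    have h₃ : f w ≤ 2 ^ q.eval w.length := by exact_mod_cast h₂
    rw [← Nat.pow_le_pow_iff_right (le_refl 2), pow_succ]
    have := (hl w).2
    omega
  have hJlen : ∀ w, J * (l w).length ≤ J * (q.eval w.length + 1) := fun w =>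
    Nat.mul_le_mul_left _ (hlen w)
  have htree := fun w => div_hasTree M F.outputAlphabet K J (w := w) (l := l w)
    (haltList_stk F.tm ((l w).map F.outputAlphabet.symm))
    (NTM.ofFinTM2_unfolds F.tm F.inputAlphabet (false, false) rfl (F.outputsFun w)) (hT w)
  refine ⟨_, ⟨(divDriver M F.outputAlphabet K J).machine,
    ⟨F.time + (pV + (3 * (Polynomial.X + 2) ^ K + 2 * (J : Polynomial ℕ) +
      (2 * (Polynomial.X + 2) ^ K + 3))) + Driver.setupTime K, fun w => ?_⟩, fun w => rfl⟩,
    p, ε / 2, by positivity, fun w => ?_⟩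
  · refine (htree w).haltsWithin.mono ?_
    have := hJlen w
    have h2 := hcoins w.length
    have h3 : J * (3 * (l w).length + 2) = 3 * (J * (l w).length) + 2 * J := by ring
    simp
    omega
  · classical
    have hacc := (htree w).numPaths_eq {true}
    set v : ℕ := 2 ^ (l w).length - f w with hv
    have hv' : v + bitsVal (l w) = 2 ^ (l w).length := by
      have := bitsVal_lt (l w)
      rw [(hl w).1] at this ⊢
      omega
    obtain ⟨m, hm⟩ : ∃ m, (w.length + 2) ^ K - t w = m + J * (l w).length :=
      ⟨(w.length + 2) ^ K - t w - J * (l w).length, by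
        have := hJlen w
        have := htp w
        have := hcoins w.length
        omega⟩
    rw [(hunif w).count_graft (B := {(true, true)})
      (c := (roundTree (l w) J true (m + J * (l w).length)).count {true}) _ (fun b => by
        rw [hm]
        by_cases hb : b = (true, true)
        · simp [hb]
        · simp [hb, CoinTree.count])] at hacc
    have hdiv := count_roundTree_true (by rw [(hl w).1]; exact hf w) hv' J m
    have hpq : p.eval w.length + q.eval w.length = m + J * (l w).length + t w := by
      have := hJlen w
      have := htp w
      have := hcoins w.length
      simp [hp]
      omega
    have hcond : probOutGivenPost V w =
        ((T w).count {(true, true)} / 2 ^ t w : ℝ) / (f w / 2 ^ q.eval w.length) := by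
      have h₁ := (hL w).1
      rw [probPost] at h₁
      have hset : {y : Bool × Bool | y.2 = true ∧ y.1 = true} = {(true, true)} := by
        ext ⟨x, y⟩
        simp [and_comm]
      rw [probOutGivenPost, h₁, hprob, hset]
    have happ := approx_div (a := (T w).count {(true, true)}) (hf w)
      (by rw [← (hl w).1]; exact hv') (hl w).2 (by rw [← (hl w).1]; exact hdiv) hpq
    rw [← hcond, ← hacc] at happ
    obtain ⟨hup, hlow⟩ := happ
    change ((divDriver M F.outputAlphabet K J).machine.numPaths w {true} : ℝ) / _ ≤ _ at hup
    refine ⟨fun hw => ⟨?_, ?_⟩, fun hw => ⟨?_, ?_⟩⟩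
    · obtain ⟨h₁, -⟩ := (hL w).2.1 hw
      refine lt_of_lt_of_le ?_ hlow
      have h₂ : (1 / 2 : ℝ) ^ J * (2 * (1 + ε)) < ε := (lt_div_iff₀ (by positivity)).1 hJ
      have h₃ : (1 / 2 : ℝ) ^ J ≤ 1 := pow_le_one₀ (by norm_num) (by norm_num)
      have h₄ := mul_le_mul_of_nonneg_right h₁ (sub_nonneg.2 h₃)
      refine lt_of_lt_of_le ?_ h₄
      linarith
    · exact hup.trans ((hL w).2.1 hw).2
    · positivity
    · refine hup.trans_lt (((hL w).2.2 hw).2.trans_lt ?_)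
      linarith

end Complexity

theorem theorem6 :
    Complexity.UP ∩ Complexity.coUP ⊆ Complexity.postBPP_FP ∧
      Complexity.postBPP_FP ⊆ Complexity.WAPP :=
  ⟨Complexity.UP_inter_coUP_subset, Complexity.postBPP_FP_subset⟩
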